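/- Let $0<q<1$, $(a;q)_n=\prod_{i=0}^{n-1}(1-aq^i)$, $(a;q)_\infty=\prod_{i\ge 0}(1-aq^i)$, and let $p_n(q^x;a;q)=\sum_{j=0}^{n}\frac{(q^{-n};q)_j}{(aq;q)_j(q;q)_j}q^{(x+1)j}$ be the Wall polynomials and $$\bar p_n(q^x;a;q)=(-1)^{n+x}\sqrt{\frac{(aq)^{x-n}(aq;q)_\infty(aq;q)_n}{(q;q)_n(q;q)_x}}\;p_n(q^x;a;q),\qquad n,x\in\mathbb N=\{0,1,2,\dots\}.$$ For $x,m,n\in\mathbb Z$ put $C_{x,m,n}=\bar p_{\min(m,n)}(q^{2x};q^{2|n-m|};q^2)$ if $x,m,n\ge0$, and $C_{x,m,n}=0$ otherwise. Let $\{e_n\}_{n\in\mathbb N}$ be the standard basis of $\ell^2(\mathbb N)$. **$6j$-symbols.** For $y\in\mathbb N$ and $p,r\in\mathbb Z$ define vectors in $\ell^2(\mathbb N)^{\otimes 3}$ by $$e^{1(23)}_{y,p,r}=\sum_{n-m+l=y-r}C_{y,n,n+p}\,C_{n+p,m,l}\;e_n\otimes e_m\otimes e_l,\qquad e^{(12)3}_{y,p,r}=\sum_{n-m+l=y-r}C_{y,l-p,l}\,C_{l-p,n,m}\;e_n\otimes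 e_m\otimes e_l .$$ The number $R_{p_1,r_1;p_2,r_2}=\langle e^{1(23)}_{y,p_1,r_1},e^{(12)3}_{y,p_2,r_2}\rangle$ does not depend on $y\in\mathbb N$, and for integers $x,n_1,n_2,n_3,a,b$ one puts $$R^{x,n_1,n_2,n_3}_{a,b}=R_{a-n_1,\,\rho;\;n_3-b,\,\rho},\qquad \rho=x-n_1+n_2-n_3 .$$ **Trees.** For $N\ge 0$, $y,p\in\mathbb Z$ and integers $\rho_2,\rho_3,\dots$ define vectors in $\ell^2(\mathbb N)^{\otimes(N+1)}$ by $E_0(y)=e_y$ (zero for $y<0$), $E_1(y,p)=\sum_{m}C_{y,m-p,m}\,e_{m-p}\otimes e_m$ and $$E_{N+1}(y,p)=\sum_{m\in\mathbb N}C_{y,m-p,m}\;E_N(m-p,\;\rho_{N+1}-y+m)\otimes e_m\qquad(N\ge1).$$ Let $k\ge1$, $x\in\mathbb Z$, $\mathbf n\in\mathbb Z^{k+2}$, $\mathbf r,\mathbf s\in\mathbb Z^k$, and set $s_0=n_1$, $s_{k+1}=x$, $r_0=n_2$. For $y\in\mathbb N$ let $T'_{\mathbf s}(y)\in\ell^2(\mathbb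 N)^{\otimes(k+2)}$ be the vector $E_{k+1}(y,\,n_{k+2}-s_k)$ with parameters $\rho_i=s_i-s_{i-2}+n_i-n_{i+1}$ $(2\le i\le k+1)$, and let $$T_{\mathbf r}(y)=\sum_{m\in\mathbb N}C_{y,m,m+p}\;e_m\otimes E_k\bigl(m+p,\;y-m-(x-n_1+r_{k-1}-n_{k+2})\bigr),\qquad p=r_k-n_1,$$ where $E_k$ has parameters $\rho_i=r_i-r_{i-2}+n_{i+1}-n_{i+2}$ $(2\le i\le k)$. For $x\ge0$, $T'_{\mathbf s}(x)$ is the vector of the binary tree $(\cdots((n_1n_2)_{s_1}n_3)_{s_2}\cdots n_{k+1})_{s_k}n_{k+2}$ with root label $x$, and $T_{\mathbf r}(x)$ is the vector of the binary tree $n_1\,((\cdots(n_2n_3)_{r_1}\cdots n_{k+1})_{r_{k-1}}n_{k+2})_{r_k}$ with root label $x$. **Lemma.** All $T_{\mathbf r}(y)$, $T'_{\mathbf s}(y)$ are well-defined elements of $\ell^2(\mathbb N)^{\otimes(k+2)}$. The coupling coefficients $S^{x,\mathbf n}_{\mathbf r,\mathbf s}$ between the two trees, i.e. the numbers $S^{x,\mathbf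 n}_{\mathbf r,\mathbf s}=\langle T_{\mathbf r}(\max(x,0)),T'_{\mathbf s}(\max(x,0))\rangle$, are for every $y\in\mathbb N$ the unique family of complex numbers with $$T_{\mathbf r}(y)=\sum_{\mathbf s\in\mathbb Z^k}S^{x,\mathbf n}_{\mathbf r,\mathbf s}\;T'_{\mathbf s}(y)$$ (unconditional convergence in norm), and they are given by $$S^{x,\mathbf n}_{\mathbf r,\mathbf s}=\prod_{j=1}^{k}R^{\,s_{j+1},\,n_1,\,r_{j-1},\,n_{j+2}}_{\,r_j,\;s_j},\qquad s_{k+1}=x,\quad r_0=n_2 .$$ -/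

import Mathlib

open scoped BigOperators

noncomputable section

namespace QSU2

/-! ### Wall polynomials and Clebsch--Gordan coefficients -/

/-- The finite `q`-shifted factorial `(a;q)_n`. -/
def qPoch (a q : ℝ) (n : ℕ) : ℝ := ∏ i ∈ Finset.range n, (1 - a * q ^ i)

/-- The infinite `q`-shifted factorial `(a;q)_∞`. -/
def qPochInf (a q : ℝ) : ℝ := ∏' i : ℕ, (1 - a * q ^ i)

/-- The Wall polynomial `p_n(q^x;a;q) = ₂φ₁(q^{-n}, 0; aq; q, q^{x+1})`.  The series terminates,
since `(q^{-n};q)_j = 0` for `j > n`, and `(0;q)_j = 1`. -/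
def wall (n x : ℕ) (a q : ℝ) : ℝ :=
  ∑ j ∈ Finset.range (n + 1),
    qPoch (q ^ (-(n : ℤ))) q j / (qPoch (a * q) q j * qPoch q q j) * (q ^ (x + 1)) ^ j

/-- The normalized function
`(-1)^{n+x} √( (aq)^{x-n} (aq;q)_∞ (aq;q)_n / ((q;q)_n (q;q)_x) ) p_n(q^x;a;q)`. -/
def wallBar (n x : ℕ) (a q : ℝ) : ℝ :=
  (-1) ^ (n + x) *
    Real.sqrt ((a * q) ^ ((x : ℤ) - (n : ℤ)) * qPochInf (a * q) q * qPoch (a * q) q n /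
      (qPoch q q n * qPoch q q x)) * wall n x a q

/-- The Clebsch--Gordan coefficient `C_{x,m,n}`; it vanishes if `x`, `m` or `n` is negative. -/
def cg (q : ℝ) (x m n : ℤ) : ℝ :=
  if 0 ≤ x ∧ 0 ≤ m ∧ 0 ≤ n then
    wallBar (min m n).toNat x.toNat (q ^ (2 * |n - m|)) (q ^ 2)
  else 0

/-! ### The Hilbert spaces -/

/-- `ℓ²(ℕ)^{⊗N}`, realized as `ℓ²(ℕ^N)`; the basis vector `e_{m_1} ⊗ ⋯ ⊗ e_{m_N}` is the indicator
of `m`. -/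
abbrev TensorL2 (N : ℕ) : Type := lp (fun _ : Fin N → ℕ => ℂ) 2

/-- A coefficient function is square summable. -/
def IsL2 {N : ℕ} (f : (Fin N → ℕ) → ℝ) : Prop :=
  Memℓp (fun m : Fin N → ℕ => (f m : ℂ)) 2

open Classical in
/-- The vector `∑_m f(m) e_{m_1} ⊗ ⋯ ⊗ e_{m_N}` of `ℓ²(ℕ)^{⊗N}` (and `0` if `f` is not
square summable). -/
def toL2 {N : ℕ} (f : (Fin N → ℕ) → ℝ) : TensorL2 N :=
  if h : IsL2 f then ⟨fun m => (f m : ℂ), h⟩ else 0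

/-! ### The `6j`-symbols -/

/-- Coefficients of `e^{1(23)}_{x,p,r} = ∑ C_{x,n,n+p} C_{n+p,m,k} e_n ⊗ e_m ⊗ e_k`, the sum being
over `n - m + k = x - r`. -/
def eRight (q : ℝ) (x p r : ℤ) (v : Fin 3 → ℕ) : ℝ :=
  if (v 0 : ℤ) - v 1 + v 2 = x - r then
    cg q x (v 0) (v 0 + p) * cg q (v 0 + p) (v 1) (v 2)
  else 0

/-- Coefficients of `e^{(12)3}_{x,p,r} = ∑ C_{x,k-p,k} C_{k-p,n,m} e_n ⊗ e_m ⊗ e_k`, the sum being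
over `n - m + k = x - r`. -/
def eLeft (q : ℝ) (x p r : ℤ) (v : Fin 3 → ℕ) : ℝ :=
  if (v 0 : ℤ) - v 1 + v 2 = x - r then
    cg q x (v 2 - p) (v 2) * cg q (v 2 - p) (v 0) (v 1)
  else 0

/-- The `6j`-symbol `R^y_{p₁,r₁;p₂,r₂} = ⟨e^{1(23)}_{y,p₁,r₁}, e^{(12)3}_{y,p₂,r₂}⟩`, for `y ∈ ℕ`.
(All coefficients are real, so the order of the two arguments is immaterial.) -/
def sixJ (q : ℝ) (y : ℕ) (p₁ r₁ p₂ r₂ : ℤ) : ℂ :=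
  inner ℂ (toL2 (eLeft q y p₂ r₂)) (toL2 (eRight q y p₁ r₁))

/-- The `6j`-symbol in tree notation: `R^{x,n₁,n₂,n₃}_{a,b} = R_{a-n₁,r;n₃-b,r}` where
`r = x - n₁ + n₂ - n₃`.  Since `R^y_{p₁,r₁;p₂,r₂}` does not depend on `y ∈ ℕ`, the tree notation
makes sense for negative `x` too; the superscript used is then `y = 0`. -/
def racah (q : ℝ) (x n₁ n₂ n₃ a b : ℤ) : ℂ :=
  sixJ q x.toNat (a - n₁) (x - n₁ + n₂ - n₃) (n₃ - b) (x - n₁ + n₂ - n₃)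

/-! ### Vectors attached to binary trees -/

/-- Coefficients of the vectors `e^{(⋯((12)3)⋯)}_{x,p,ρ}` in `ℓ²(ℕ)^{⊗(N+1)}`, given by
`E_0(x) = e_x` and
`E_{N+1}(x,p) = ∑_m C_{x,m-p,m} E_N(m-p, ρ_{N+1}-x+m) ⊗ e_m`.
For `N + 1 = 1` this is `e^{12}_{x,p}` and for `N + 1 = 2` it is `e^{(12)3}_{x,p,ρ_2}`
(the value `ρ_1` plays no role). -/
def comb (q : ℝ) (ρ : ℕ → ℤ) : (N : ℕ) → (x p : ℤ) → (Fin (N + 1) → ℕ) → ℝ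
  | 0, x, _, m => if (m 0 : ℤ) = x then 1 else 0
  | N + 1, x, p, m =>
      cg q x (m (Fin.last (N + 1)) - p) (m (Fin.last (N + 1))) *
        comb q ρ N (m (Fin.last (N + 1)) - p) (ρ (N + 1) - x + m (Fin.last (N + 1)))
          (Fin.init m)

/-- The sequence `a, v_1, …, v_k, b, b, …`, indexed from `0`. -/
def seq {k : ℕ} (a : ℤ) (v : Fin k → ℤ) (b : ℤ) : ℕ → ℤ
  | 0 => a
  | j + 1 => if h : j < k then v ⟨j, h⟩ else b

/-- The leaf labels `n_1, n_2, …` as a sequence indexed from `1`. -/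
def leaf {k : ℕ} (n : Fin k → ℤ) : ℕ → ℤ := seq 0 n 0

/-- The parameters `ρ_i = s_i - s_{i-2} + n_i - n_{i+1}` (`i ≥ 2`) of the tree whose node `s_i`
has left child `s_{i-1}` and right leaf `n_{i+1}`, where `s_0 = n_1`.  Its value at `i = 1` plays
no role. -/
def multLabel (s n : ℕ → ℤ) (i : ℕ) : ℤ := s i - s (i - 2) + n i - n (i + 1)

/-- Coefficients of the vector of the tree
`(⋯((n_1 n_2)_{s_1} n_3)_{s_2} ⋯ n_{k+1})_{s_k} n_{k+2}`, with root label `x`, at level `y`: that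
is, `e_{y,p,ρ}` with the parameters `p = n_{k+2} - s_k` and `ρ` given by the labels.  The vector
of the tree itself is the case `y = x`. -/
def treeS (q : ℝ) {k : ℕ} (n : Fin (k + 2) → ℤ) (s : Fin k → ℤ) (x y : ℤ) :
    (Fin (k + 2) → ℕ) → ℝ :=
  let s' := seq (leaf n 1) s x
  comb q (multLabel s' (leaf n)) (k + 1) y (leaf n (k + 2) - s' k)

/-- Coefficients of the vector of the tree
`n_1 ((⋯(n_2 n_3)_{r_1} ⋯ n_{k+1})_{r_{k-1}} n_{k+2})_{r_k}`, with root label `x`, at level `y`: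
that is, `e_{y,p,r,ρ} = ∑_m C_{y,m,m+p} e_m ⊗ E(m+p, y-m-r)` with `p = r_k - n_1`,
`r = x - n_1 + r_{k-1} - n_{k+2}` and `ρ` given by the labels, where `r_0 = n_2`.  The vector
of the tree itself is the case `y = x`. -/
def treeR (q : ℝ) {k : ℕ} (n : Fin (k + 2) → ℤ) (r : Fin k → ℤ) (x y : ℤ)
    (m : Fin (k + 2) → ℕ) : ℝ :=
  let r' := seq (leaf n 2) r 0
  let p := r' k - leaf n 1
  cg q y (m 0) (m 0 + p) *
    comb q (multLabel r' (fun i => leaf n (i + 1))) k (m 0 + p)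
      (y - m 0 - (x - leaf n 1 + r' (k - 1) - leaf n (k + 2))) (Fin.tail m)

/-- The `3nj`-symbol `S^{x,n}_{r,s}`: the coupling coefficient between the two trees, i.e. the inner
product of their vectors (at level `y = x`).  For `x < 0`, where both vectors of the trees
themselves vanish, it is taken at level `y = 0`, as for the `6j`-symbols. -/
def couplingS (q : ℝ) {k : ℕ} (x : ℤ) (n : Fin (k + 2) → ℤ) (r s : Fin k → ℤ) : ℂ :=
  inner ℂ (toL2 (treeS q n s x x.toNat)) (toL2 (treeR q n r x x.toNat))

end QSU2

end

noncomputable section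

namespace QSU2

/-! ### Shifted factorials and contiguous relations for Wall polynomials -/

/-! The quantum SU(2) algebra acts on ℓ²(ℕ) by α e_m = √(1-q^{2m}) e_{m-1} and γ e_m = q^m e_m, and
the numbers C_{x,m,n} intertwine this representation with its tensor square. Concretely, the
contiguous relations of the Wall polynomials become `cg_gamma`, `cg_gamma_star`, `cg_alpha` and
`cg_alpha_star`, valid for all integer indices because the boundary terms vanish. Apart from these
relations, only the explicit column m = 0 of C is used.

Moving α and γ across inner products (`tsum_shift_adjoint`) makes C orthogonal along columns
(`tsum_cg_mul_cg_col`) and along rows (`tsum_cg_mul_cg_row`). Row orthogonality makes the vectors of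
left-branched trees orthonormal (`comb_orthonormal`). Column orthogonality gives Parseval's identity
for the vectors e^{(12)3} (`tsum_eLeft_sq`), so that each e^{1(23)} expands in them
(`eRight_hasSum`). By coassociativity γ and α act on both bracketings in the same way. Hence the
coefficients vanish unless y and r agree, are unchanged by a common shift of the two p's, and do not
depend on y: they are the 6j-symbols.

For the product formula, recouple the leaf n_1, the subtree with root r_{k-1} and the leaf n_{k+2}.
This replaces the right-branched tree by a sum over b = s_k of one 6j-symbol times a tree with right
leaf n_{k+2}, whose left child is a shorter right-branched tree with root b (`combR_succ_hasSum`).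
Induction on k (`treeComb_hasSum`) contributes one factor per step. The iterated sums may be merged
since, by Bessel, both the products of 6j-symbols and the coordinates of the orthonormal trees are
square summable. The same square summability turns coordinatewise into norm convergence
(`hasSum_toL2`), and orthonormality gives uniqueness. -/

lemma qPoch_zero (a q : ℝ) : qPoch a q 0 = 1 := by simp [qPoch]

lemma qPoch_succ (a q : ℝ) (n : ℕ) : qPoch a q (n + 1) = qPoch a q n * (1 - a * q ^ n) :=
  Finset.prod_range_succ _ _

lemma qPoch_succ' (a q : ℝ) (n : ℕ) : qPoch a q (n + 1) = (1 - a) * qPoch (a * q) q n := by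
  rw [qPoch, Finset.prod_range_succ', mul_comm]
  simp [qPoch, pow_succ', mul_assoc]

lemma one_sub_pow_pos {t : ℝ} (h0 : 0 < t) (h1 : t < 1) (n : ℕ) : 0 < 1 - t ^ (n + 1) :=
  sub_pos.2 (pow_lt_one₀ h0.le h1 (Nat.succ_ne_zero n))

lemma qPoch_self_succ (t : ℝ) (n : ℕ) : qPoch t t (n + 1) = qPoch t t n * (1 - t ^ (n + 1)) := by
  rw [qPoch_succ, pow_succ']

lemma qPoch_self_pos {t : ℝ} (h0 : 0 < t) (h1 : t < 1) (n : ℕ) : 0 < qPoch t t n := by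
  induction n with
  | zero => simp [qPoch_zero]
  | succ n ih => rw [qPoch_self_succ]; exact mul_pos ih (one_sub_pow_pos h0 h1 n)

lemma qPoch_self_add (t : ℝ) (c j : ℕ) :
    qPoch t t (c + j) = qPoch t t c * qPoch (t ^ c * t) t j := by
  induction j with
  | zero => simp [qPoch_zero]
  | succ j ih => rw [← add_assoc, qPoch_succ, ih, qPoch_succ]; ring

lemma qPoch_neg_pow_eq_zero {t : ℝ} (h0 : 0 < t) {m j : ℕ} (h : m < j) :
    qPoch (t ^ (-(m : ℤ))) t j = 0 := by
  refine Finset.prod_eq_zero (Finset.mem_range.2 h) ?_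
  rw [zpow_neg, zpow_natCast, inv_mul_cancel₀ (pow_pos h0 m).ne', sub_self]

/-- The coefficients of the `₂φ₁` series, divided by `(t;t)_c`. -/
def wallCoeff (t u : ℝ) (c j : ℕ) : ℝ := qPoch u t j / (qPoch t t (c + j) * qPoch t t j)

/-- The Wall polynomial with parameter `t^c`, divided by `(t;t)_c`, as a function of `t^{x+1}`. -/
def wallSum (t : ℝ) (m c : ℕ) (z : ℝ) : ℝ :=
  ∑ j ∈ Finset.range (m + 1), wallCoeff t (t ^ (-(m : ℤ))) c j * z ^ j

lemma wallSum_eq {t : ℝ} (h0 : 0 < t) {m M : ℕ} (h : m < M) (c : ℕ) (z : ℝ) :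
    wallSum t m c z = ∑ j ∈ Finset.range M, wallCoeff t (t ^ (-(m : ℤ))) c j * z ^ j := by
  refine Finset.sum_subset (Finset.range_mono h) fun j _ hj => ?_
  rw [wallCoeff, qPoch_neg_pow_eq_zero h0 (by simpa using hj)]
  simp

/-! ### Contiguous relations for a single power of the variable. -/

section coeff

variable {t : ℝ} (h0 : 0 < t) (h1 : t < 1) {u : ℝ} (c j : ℕ)
include h0 h1

/-- In this section u stands for t^{-(m+1)}, so that u t = t^{-m} belongs to the degree one lower;
each relation is then a rational identity in u, t^c and t^j. -/
lemma wallCoeff_raise (hu : u ≠ 0) :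
    (1 - t ^ (c + 1) / u) * wallCoeff t u (c + 1) j
      - t ^ (c + 1) * (1 - 1 / u) * wallCoeff t (u * t) (c + 1) j = wallCoeff t u c j := by
  have e1 := qPoch_self_succ t (c + j)
  have e2 : qPoch u t j * (1 - u * t ^ j) = (1 - u) * qPoch (u * t) t j := by
    rw [← qPoch_succ, qPoch_succ']
  have p1 := (qPoch_self_pos h0 h1 (c + j)).ne'
  have p2 := (qPoch_self_pos h0 h1 j).ne'
  have p3 := (one_sub_pow_pos h0 h1 (c + j)).ne'
  rw [wallCoeff, wallCoeff, wallCoeff, show c + 1 + j = c + j + 1 by ring, e1]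
  field_simp
  linear_combination (-t ^ (c + 1)) * e2

lemma wallCoeff_lower :
    wallCoeff t (u * t) c (j + 1) - wallCoeff t u c (j + 1) = u * wallCoeff t (u * t) (c + 1) j := by
  have e1 := qPoch_self_succ t j
  have e2 := qPoch_succ' u t j
  have e3 := qPoch_succ (u * t) t j
  have p1 := (qPoch_self_pos h0 h1 (c + 1 + j)).ne'
  have p2 := (qPoch_self_pos h0 h1 j).ne'
  have p3 := (one_sub_pow_pos h0 h1 j).ne'
  rw [wallCoeff, wallCoeff, wallCoeff, show c + (j + 1) = c + 1 + j by ring, e1, e2, e3]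
  field_simp
  ring

/-- The division by t^(j+1) absorbs the argument t z on the left of `wallSum_down`; the difference
of consecutive coefficients comes from its factor 1 - z. -/
lemma wallCoeff_down_succ (hu : u ≠ 0) :
    (1 - t ^ c / u) * wallCoeff t u c (j + 1) + t ^ c / u * wallCoeff t (u * t) c (j + 1)
      = (wallCoeff t (u * t) c (j + 1) - wallCoeff t (u * t) c j) / t ^ (j + 1) := by
  have e1 := qPoch_self_succ t j
  have e4 := qPoch_self_succ t (c + j)
  have e2 := qPoch_succ' u t j
  have e3 := qPoch_succ (u * t) t j
  have p1 := (qPoch_self_pos h0 h1 (c + j)).ne'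
  have p2 := (qPoch_self_pos h0 h1 j).ne'
  have p3 := (one_sub_pow_pos h0 h1 j).ne'
  have p4 := (one_sub_pow_pos h0 h1 (c + j)).ne'
  rw [wallCoeff, wallCoeff, wallCoeff, ← add_assoc, e1, e2, e3, e4]
  field_simp
  ring

omit h0 h1 in
lemma wallCoeff_down_zero :
    (1 - t ^ c / u) * wallCoeff t u c 0 + t ^ c / u * wallCoeff t (u * t) c 0
      = wallCoeff t (u * t) c 0 := by
  simp only [wallCoeff, qPoch_zero]
  ring

lemma wallCoeff_up (hu : u ≠ 0) :
    (1 - 1 / u) * wallCoeff t (u * t) c j + 1 / u * wallCoeff t u c j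
      = t ^ j * wallCoeff t u c j := by
  have e2 : qPoch u t j * (1 - u * t ^ j) = (1 - u) * qPoch (u * t) t j := by
    rw [← qPoch_succ, qPoch_succ']
  have p1 := (qPoch_self_pos h0 h1 (c + j)).ne'
  have p2 := (qPoch_self_pos h0 h1 j).ne'
  rw [wallCoeff, wallCoeff]
  field_simp
  linear_combination e2

end coeff

/-! ### Contiguous relations for Wall polynomials. -/

section sums

variable {t : ℝ} (h0 : 0 < t) (h1 : t < 1) (m c : ℕ) (z : ℝ)
include h0 h1

omit h1 in
lemma zpow_neg_succ_mul : t ^ (-((m + 1 : ℕ) : ℤ)) * t = t ^ (-(m : ℤ)) := by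
  rw [← zpow_add_one₀ h0.ne']; congr 1; push_cast; ring

/-- Degree 0 is the formal case m = -1 of `wallSum_raise`, where the coefficient 1 - t^(m+1) of the
missing term vanishes. -/
lemma wallSum_raise_zero :
    (1 - t ^ (c + 1)) * wallSum t 0 (c + 1) z = wallSum t 0 c z := by
  have := wallCoeff_raise h0 h1 c 0 one_ne_zero
  simp only [wallSum, zero_add, Finset.sum_range_one, Nat.cast_zero, neg_zero, zpow_zero, pow_zero,
    mul_one]
  rw [← this]; ring

lemma wallSum_raise :
    (1 - t ^ (m + 1 + c + 1)) * wallSum t (m + 1) (c + 1) z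
      - t ^ (c + 1) * (1 - t ^ (m + 1)) * wallSum t m (c + 1) z = wallSum t (m + 1) c z := by
  rw [wallSum_eq h0 (show m < m + 2 by omega), wallSum, wallSum, Finset.mul_sum, Finset.mul_sum,
    ← Finset.sum_sub_distrib]
  refine Finset.sum_congr rfl fun j _ => ?_
  have hu : t ^ (-((m + 1 : ℕ) : ℤ)) ≠ 0 := (zpow_pos h0 _).ne'
  rw [← wallCoeff_raise h0 h1 c j hu, zpow_neg_succ_mul h0, zpow_neg, zpow_natCast]
  simp only [div_inv_eq_mul]
  ring

lemma wallSum_lower :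
    wallSum t m c z - wallSum t (m + 1) c z
      = t ^ (-((m + 1 : ℕ) : ℤ)) * z * wallSum t m (c + 1) z := by
  rw [wallSum_eq h0 (show m < m + 2 by omega), wallSum, wallSum, ← Finset.sum_sub_distrib,
    Finset.sum_range_succ', Finset.mul_sum]
  have h := zpow_neg_succ_mul h0 m
  have : ∀ u : ℝ, wallCoeff t u c 0 = 1 / qPoch t t c := fun u => by simp [wallCoeff, qPoch_zero]
  rw [this, this, sub_self, add_zero]
  refine Finset.sum_congr rfl fun j _ => ?_
  rw [← sub_mul, ← h, wallCoeff_lower h0 h1]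
  ring

lemma wallSum_down :
    (1 - t ^ (m + c + 1)) * wallSum t (m + 1) c (t * z) + t ^ (m + c + 1) * wallSum t m c (t * z)
      = (1 - z) * wallSum t m c z := by
  have e : (1 - z) * wallSum t m c z =
      ∑ j ∈ Finset.range (m + 2), wallCoeff t (t ^ (-(m : ℤ))) c j * z ^ j
       - ∑ j ∈ Finset.range (m + 1), wallCoeff t (t ^ (-(m : ℤ))) c j * z ^ (j + 1) := by
    rw [← wallSum_eq h0 (show m < m + 2 by omega), sub_mul, one_mul]
    congr 1
    rw [wallSum, Finset.mul_sum]
    refine Finset.sum_congr rfl fun j _ => ?_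
    ring
  have hu : t ^ (-((m + 1 : ℕ) : ℤ)) ≠ 0 := (zpow_pos h0 _).ne'
  have hv : t ^ c / t ^ (-((m + 1 : ℕ) : ℤ)) = t ^ (m + c + 1) := by
    rw [zpow_neg, zpow_natCast, div_inv_eq_mul]; ring
  rw [e, wallSum_eq h0 (show m < m + 1 + 1 by omega), wallSum]
  simp only [Finset.sum_range_succ' _ (m + 1)]
  have h := zpow_neg_succ_mul h0 m
  have k0 := wallCoeff_down_zero (t := t) (u := t ^ (-((m + 1 : ℕ) : ℤ))) c
  rw [h, hv] at k0
  have ks : ∀ j ∈ Finset.range (m + 1),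
      (1 - t ^ (m + c + 1)) * (wallCoeff t (t ^ (-((m + 1 : ℕ) : ℤ))) c (j + 1) * (t * z) ^ (j + 1))
       + t ^ (m + c + 1) * (wallCoeff t (t ^ (-(m : ℤ))) c (j + 1) * (t * z) ^ (j + 1))
       = wallCoeff t (t ^ (-(m : ℤ))) c (j + 1) * z ^ (j + 1)
        - wallCoeff t (t ^ (-(m : ℤ))) c j * z ^ (j + 1) := by
    intro j _
    have := wallCoeff_down_succ h0 h1 c j hu
    rw [h, hv, eq_div_iff (pow_pos h0 _).ne'] at this
    rw [mul_pow]
    linear_combination z ^ (j + 1) * this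
  have := Finset.sum_congr rfl ks
  rw [Finset.sum_add_distrib, Finset.sum_sub_distrib, ← Finset.mul_sum, ← Finset.mul_sum] at this
  simp only [pow_zero, mul_one]
  linear_combination this + k0

omit h0 h1 in
lemma wallSum_up_zero : wallSum t 0 c z = wallSum t 0 c (t * z) := by
  simp [wallSum]

lemma wallSum_up :
    (1 - t ^ (m + 1)) * wallSum t m c z + t ^ (m + 1) * wallSum t (m + 1) c z
      = wallSum t (m + 1) c (t * z) := by
  rw [wallSum_eq h0 (show m < m + 2 by omega), wallSum, wallSum, Finset.mul_sum, Finset.mul_sum,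
    ← Finset.sum_add_distrib]
  refine Finset.sum_congr rfl fun j _ => ?_
  have hu : t ^ (-((m + 1 : ℕ) : ℤ)) ≠ 0 := (zpow_pos h0 _).ne'
  have := wallCoeff_up h0 h1 c j hu
  rw [zpow_neg_succ_mul h0, zpow_neg, zpow_natCast] at this
  simp only [one_div, inv_inv] at this
  rw [zpow_neg (t) ((m + 1 : ℕ) : ℤ), zpow_natCast, mul_pow]
  linear_combination z ^ j * this

end sums

/-! ### Infinite products -/

lemma multipliable_qPochInf {t : ℝ} (h0 : 0 < t) (h1 : t < 1) (a : ℝ) :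
    Multipliable fun i : ℕ => 1 - a * t ^ i := by
  have : Summable fun i : ℕ => -(a * t ^ i) :=
    ((summable_geometric_of_lt_one h0.le h1).mul_left a).neg
  simpa [sub_eq_add_neg] using Real.multipliable_one_add_of_summable this

lemma tendsto_qPoch {t : ℝ} (h0 : 0 < t) (h1 : t < 1) (a : ℝ) :
    Filter.Tendsto (qPoch a t) Filter.atTop (nhds (qPochInf a t)) :=
  (multipliable_qPochInf h0 h1 a).tendsto_prod_tprod_nat

lemma qPochInf_self_ne_zero {t : ℝ} (h0 : 0 < t) (h1 : t < 1) : qPochInf t t ≠ 0 := by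
  have : Summable fun i : ℕ => ‖-(t * t ^ i)‖ :=
    ((summable_geometric_of_lt_one h0.le h1).mul_left t).neg.norm
  have h := tprod_one_add_ne_zero_of_summable (f := fun i : ℕ => -(t * t ^ i)) (fun i => by
    have := one_sub_pow_pos h0 h1 i
    rw [pow_succ'] at this
    rw [← sub_eq_add_neg]; exact this.ne') this
  simpa [qPochInf, sub_eq_add_neg] using h

lemma qPochInf_self_pos {t : ℝ} (h0 : 0 < t) (h1 : t < 1) : 0 < qPochInf t t :=
  lt_of_le_of_ne (ge_of_tendsto' (tendsto_qPoch h0 h1 t) fun n => (qPoch_self_pos h0 h1 n).le)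
    (qPochInf_self_ne_zero h0 h1).symm

lemma qPochInf_self_eq {t : ℝ} (h0 : 0 < t) (h1 : t < 1) (c : ℕ) :
    qPochInf t t = qPoch t t c * qPochInf (t ^ c * t) t := by
  have h := ((Filter.tendsto_add_atTop_iff_nat c).2 (tendsto_qPoch h0 h1 t))
  have h' := (tendsto_qPoch h0 h1 (t ^ c * t)).const_mul (qPoch t t c)
  refine tendsto_nhds_unique h (h'.congr fun j => ?_)
  rw [add_comm j c, qPoch_self_add]

/-! ### Contiguous relations for the Clebsch--Gordan coefficients -/

/-- The matrix coefficient `√(1-q^{2m})` of the annihilation operator; it vanishes for `m ≤ 0`. -/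
def lad (q : ℝ) (m : ℤ) : ℝ := Real.sqrt (1 - (q ^ 2) ^ m.toNat)

/-- The eigenvalue `q^m` of `γ`, for `m ≥ 0`. -/
def gam (q : ℝ) (m : ℤ) : ℝ := q ^ m.toNat

/-- The square root of `(q²;q²)_n`. -/
def sqrtPoch (q : ℝ) (n : ℕ) : ℝ := Real.sqrt (qPoch (q ^ 2) (q ^ 2) n)

/-- The coefficient `C_{x,m,m+c}` for natural numbers `x`, `m`, `c`, with the powers of `q` and the
shifted factorials collected. -/
def cgNat (q : ℝ) (x m c : ℕ) : ℝ :=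
  (-1) ^ (m + x) * (q ^ ((c + 1) * x) / q ^ ((c + 1) * m)) *
    (Real.sqrt (qPochInf (q ^ 2) (q ^ 2)) * sqrtPoch q (m + c) / (sqrtPoch q m * sqrtPoch q x)) *
      wallSum (q ^ 2) m c ((q ^ 2) ^ (x + 1))

lemma lad_zero (q : ℝ) : lad q 0 = 0 := by simp [lad]

lemma lad_of_nonpos (q : ℝ) {m : ℤ} (h : m ≤ 0) : lad q m = 0 := by
  simp [lad, Int.toNat_of_nonpos h]

section

variable {q : ℝ} (hq₀ : 0 < q) (hq₁ : q < 1)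
include hq₀ hq₁

lemma sq_pos_lt_one : 0 < q ^ 2 ∧ q ^ 2 < 1 := ⟨by positivity, by nlinarith⟩

lemma lad_sq (n : ℕ) : lad q (n + 1 : ℕ) ^ 2 = 1 - (q ^ 2) ^ (n + 1) := by
  obtain ⟨h0, h1⟩ := sq_pos_lt_one hq₀ hq₁
  rw [lad, Int.toNat_natCast, Real.sq_sqrt (one_sub_pow_pos h0 h1 n).le]

lemma lad_pos (n : ℕ) : 0 < lad q (n + 1 : ℕ) := by
  obtain ⟨h0, h1⟩ := sq_pos_lt_one hq₀ hq₁
  rw [lad, Int.toNat_natCast]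
  exact Real.sqrt_pos.2 (one_sub_pow_pos h0 h1 n)

lemma sqrtPoch_pos (n : ℕ) : 0 < sqrtPoch q n := by
  obtain ⟨h0, h1⟩ := sq_pos_lt_one hq₀ hq₁
  exact Real.sqrt_pos.2 (qPoch_self_pos h0 h1 n)

lemma sqrtPoch_sq (n : ℕ) : sqrtPoch q n ^ 2 = qPoch (q ^ 2) (q ^ 2) n := by
  obtain ⟨h0, h1⟩ := sq_pos_lt_one hq₀ hq₁
  exact Real.sq_sqrt (qPoch_self_pos h0 h1 n).le

lemma sqrtPoch_succ (n : ℕ) : sqrtPoch q (n + 1) = lad q (n + 1 : ℕ) * sqrtPoch q n := by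
  obtain ⟨h0, h1⟩ := sq_pos_lt_one hq₀ hq₁
  rw [sqrtPoch, qPoch_self_succ, Real.sqrt_mul (qPoch_self_pos h0 h1 n).le, mul_comm, lad,
    Int.toNat_natCast, sqrtPoch]

omit hq₀ hq₁ in
lemma wall_eq {t : ℝ} (h0 : 0 < t) (h1 : t < 1) (n x c : ℕ) :
    wall n x (t ^ c) t = qPoch t t c * wallSum t n c (t ^ (x + 1)) := by
  rw [wall, wallSum, Finset.mul_sum]
  refine Finset.sum_congr rfl fun j _ => ?_
  rw [wallCoeff, qPoch_self_add]
  have := (qPoch_self_pos h0 h1 c).ne'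
  by_cases h : qPoch (t ^ c * t) t j = 0
  · simp [h]
  · field_simp

lemma wallBar_eq (m x c : ℕ) : wallBar m x ((q ^ 2) ^ c) (q ^ 2) = cgNat q x m c := by
  obtain ⟨h0, h1⟩ := sq_pos_lt_one hq₀ hq₁
  set t := q ^ 2 with ht
  have hI := (qPochInf_self_pos h0 h1)
  have hc := qPoch_self_pos h0 h1 c
  have e1 : qPochInf (t ^ c * t) t = qPochInf t t / qPoch t t c := by
    rw [qPochInf_self_eq h0 h1 c]; field_simp
  have e2 : qPoch (t ^ c * t) t m = qPoch t t (m + c) / qPoch t t c := by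
    rw [add_comm, qPoch_self_add]; field_simp
  have e3 : (t ^ c * t) ^ ((x : ℤ) - (m : ℤ)) = (q ^ ((c + 1) * x) / q ^ ((c + 1) * m)) ^ 2 := by
    rw [zpow_sub₀ (by positivity), zpow_natCast, zpow_natCast, ht]
    rw [div_pow]; congr 1 <;> ring
  have b1 := sqrtPoch_pos hq₀ hq₁ m
  have b2 := sqrtPoch_pos hq₀ hq₁ x
  have b3 := sqrtPoch_pos hq₀ hq₁ (m + c)
  -- The radicand is a perfect square; its denominator (t;t)_c cancels the factor (t;t)_c of
  -- `wall_eq`.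
  have e4 : (t ^ c * t) ^ ((x : ℤ) - (m : ℤ)) * qPochInf (t ^ c * t) t * qPoch (t ^ c * t) t m /
      (qPoch t t m * qPoch t t x) = (q ^ ((c + 1) * x) / q ^ ((c + 1) * m) *
    (Real.sqrt (qPochInf t t) * sqrtPoch q (m + c) / (sqrtPoch q m * sqrtPoch q x)) /
      qPoch t t c) ^ 2 := by
    have hs := Real.sq_sqrt hI.le
    rw [e1, e2, e3, ← sqrtPoch_sq hq₀ hq₁ m, ← sqrtPoch_sq hq₀ hq₁ x, ← sqrtPoch_sq hq₀ hq₁ (m + c)]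
    generalize Real.sqrt (qPochInf t t) = I at *
    rw [← hs]
    field_simp
  rw [wallBar, e4, Real.sqrt_sq (by positivity), wall_eq h0 h1, cgNat, ← ht]
  field_simp

lemma cg_natCast (x m c : ℕ) : cg q x m (m + c : ℕ) = cgNat q x m c := by
  rw [cg, if_pos ⟨by positivity, by positivity, by positivity⟩, ← wallBar_eq hq₀ hq₁]
  congr 1
  · simp
  · push_cast
    rw [add_sub_cancel_left, abs_of_nonneg (by positivity), ← pow_mul]
    exact_mod_cast rfl

/-- The `cgNat` relations are those of `wallSum` with the normalization restored. `raise` and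
`lower` encode γ on the two sides of the diagonal, `down` encodes α and `up` encodes α*. -/
lemma cgNat_raise_zero (x c : ℕ) :
    lad q (c + 1 : ℕ) * cgNat q x 0 (c + 1) = q ^ x * cgNat q x 0 c := by
  obtain ⟨h0, h1⟩ := sq_pos_lt_one hq₀ hq₁
  have R := wallSum_raise_zero h0 h1 c ((q ^ 2) ^ (x + 1))
  have b2 := sqrtPoch_pos hq₀ hq₁ x
  have b0 := sqrtPoch_pos hq₀ hq₁ 0
  rw [← lad_sq hq₀ hq₁] at R
  rw [cgNat, cgNat, ← R, zero_add, zero_add, sqrtPoch_succ hq₀ hq₁]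
  generalize wallSum _ _ _ _ = W1
  generalize lad q _ = A at *
  field_simp
  ring_nf

lemma cgNat_raise (x m c : ℕ) :
    q ^ (m + 1) * lad q (m + 1 + c + 1 : ℕ) * cgNat q x (m + 1) (c + 1)
      + lad q (m + 1 : ℕ) * q ^ (m + 1 + c) * cgNat q x m (c + 1)
      = q ^ x * cgNat q x (m + 1) c := by
  obtain ⟨h0, h1⟩ := sq_pos_lt_one hq₀ hq₁
  have R := wallSum_raise h0 h1 m c ((q ^ 2) ^ (x + 1))
  have b2 := sqrtPoch_pos hq₀ hq₁ x
  have b0 := sqrtPoch_pos hq₀ hq₁ m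
  have a1 := lad_pos hq₀ hq₁ m
  rw [← lad_sq hq₀ hq₁, ← lad_sq hq₀ hq₁] at R
  rw [cgNat, cgNat, cgNat, ← R, show m + 1 + (c + 1) = m + 1 + c + 1 by ring,
    show m + (c + 1) = m + 1 + c by ring, sqrtPoch_succ hq₀ hq₁ (m + 1 + c),
    sqrtPoch_succ hq₀ hq₁ m]
  generalize wallSum _ (m + 1) _ _ = W1
  generalize wallSum _ _ _ _ = W2
  generalize lad q (m + 1 : ℕ) = A at *
  generalize lad q _ = B at *
  field_simp
  ring

lemma cgNat_lower (x m c : ℕ) :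
    q ^ m * lad q (m + c + 1 : ℕ) * cgNat q x m c
      + lad q (m + 1 : ℕ) * q ^ (m + c + 1) * cgNat q x (m + 1) c
      = q ^ x * cgNat q x m (c + 1) := by
  obtain ⟨h0, h1⟩ := sq_pos_lt_one hq₀ hq₁
  have R := wallSum_lower h0 h1 m c ((q ^ 2) ^ (x + 1))
  rw [sub_eq_iff_eq_add, zpow_neg, zpow_natCast] at R
  have b2 := sqrtPoch_pos hq₀ hq₁ x
  have b0 := sqrtPoch_pos hq₀ hq₁ m
  have a1 := lad_pos hq₀ hq₁ m
  rw [cgNat, cgNat, cgNat, R, show m + (c + 1) = m + c + 1 by ring,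
    show m + 1 + c = m + c + 1 by ring, sqrtPoch_succ hq₀ hq₁ (m + c),
    sqrtPoch_succ hq₀ hq₁ m]
  generalize wallSum _ (m + 1) _ _ = W1
  generalize wallSum _ _ _ _ = W2
  generalize lad q (m + 1 : ℕ) = A at *
  generalize lad q _ = B at *
  field_simp
  ring

lemma cgNat_down (x m c : ℕ) :
    lad q (m + 1 : ℕ) * lad q (m + c + 1 : ℕ) * cgNat q (x + 1) (m + 1) c
      - q * q ^ m * q ^ (m + c) * cgNat q (x + 1) m c
      = lad q (x + 1 : ℕ) * cgNat q x m c := by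
  obtain ⟨h0, h1⟩ := sq_pos_lt_one hq₀ hq₁
  have R := wallSum_down h0 h1 m c ((q ^ 2) ^ (x + 1))
  have b2 := sqrtPoch_pos hq₀ hq₁ x
  have b0 := sqrtPoch_pos hq₀ hq₁ m
  have a1 := lad_pos hq₀ hq₁ m
  have a2 := lad_pos hq₀ hq₁ x
  rw [← lad_sq hq₀ hq₁, ← lad_sq hq₀ hq₁, ← pow_succ'] at R
  rw [cgNat, cgNat, cgNat, show m + 1 + c = m + c + 1 by ring, sqrtPoch_succ hq₀ hq₁ (m + c),
    sqrtPoch_succ hq₀ hq₁ m, sqrtPoch_succ hq₀ hq₁ x]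
  generalize wallSum _ (m + 1) _ _ = W1 at *
  generalize wallSum _ _ _ ((q ^ 2) ^ (x + 1 + 1)) = W2 at *
  generalize wallSum _ _ _ _ = W3 at *
  generalize lad q (m + 1 : ℕ) = A at *
  generalize lad q (x + 1 : ℕ) = D at *
  generalize lad q _ = B at *
  have : W3 = (B ^ 2 * W1 + (q ^ 2) ^ (m + c + 1) * W2) / D ^ 2 := by
    rw [R]; field_simp
  rw [this]
  field_simp
  ring

lemma cgNat_down_zero (m c : ℕ) :
    lad q (m + 1 : ℕ) * lad q (m + c + 1 : ℕ) * cgNat q 0 (m + 1) c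
      - q * q ^ m * q ^ (m + c) * cgNat q 0 m c = 0 := by
  obtain ⟨h0, h1⟩ := sq_pos_lt_one hq₀ hq₁
  -- The variable is z = t^{x+1}, so z = 1 is the formal value x = -1, at which the factor 1 - z
  -- removes the right-hand side.
  have R := wallSum_down h0 h1 m c 1
  have b2 := sqrtPoch_pos hq₀ hq₁ 0
  have b0 := sqrtPoch_pos hq₀ hq₁ m
  have a1 := lad_pos hq₀ hq₁ m
  rw [← lad_sq hq₀ hq₁, mul_one] at R
  rw [cgNat, cgNat, show m + 1 + c = m + c + 1 by ring, sqrtPoch_succ hq₀ hq₁ (m + c),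
    sqrtPoch_succ hq₀ hq₁ m, zero_add, pow_one (q ^ 2)]
  generalize wallSum _ (m + 1) _ _ = W1 at *
  generalize wallSum _ _ _ (q ^ 2) = W2 at *
  generalize lad q (m + 1 : ℕ) = A at *
  generalize lad q _ = B at *
  have h : W2 = -(B ^ 2 * W1) / (q ^ 2) ^ (m + c + 1) := by
    rw [eq_div_iff (by positivity)]; linear_combination R
  rw [h]
  field_simp
  ring

lemma cgNat_up_zero (x c : ℕ) :
    - (q * q ^ c * cgNat q x 0 c) = lad q (x + 1 : ℕ) * cgNat q (x + 1) 0 c := by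
  obtain ⟨h0, h1⟩ := sq_pos_lt_one hq₀ hq₁
  have R := wallSum_up_zero (t := q ^ 2) c ((q ^ 2) ^ (x + 1))
  have b2 := sqrtPoch_pos hq₀ hq₁ x
  have b0 := sqrtPoch_pos hq₀ hq₁ 0
  have a2 := lad_pos hq₀ hq₁ x
  rw [← pow_succ'] at R
  rw [cgNat, cgNat, sqrtPoch_succ hq₀ hq₁ x, R]
  generalize wallSum _ _ _ _ = W3 at *
  generalize lad q _ = B at *
  field_simp
  ring

lemma cgNat_up (x m c : ℕ) :
    lad q (m + 1 : ℕ) * lad q (m + c + 1 : ℕ) * cgNat q x m c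
      - q * q ^ (m + 1) * q ^ (m + c + 1) * cgNat q x (m + 1) c
      = lad q (x + 1 : ℕ) * cgNat q (x + 1) (m + 1) c := by
  obtain ⟨h0, h1⟩ := sq_pos_lt_one hq₀ hq₁
  have R := wallSum_up h0 h1 m c ((q ^ 2) ^ (x + 1))
  have b2 := sqrtPoch_pos hq₀ hq₁ x
  have b0 := sqrtPoch_pos hq₀ hq₁ m
  have a1 := lad_pos hq₀ hq₁ m
  have a2 := lad_pos hq₀ hq₁ x
  rw [← lad_sq hq₀ hq₁, ← pow_succ'] at R
  rw [cgNat, cgNat, cgNat, ← R, show m + 1 + c = m + c + 1 by ring, sqrtPoch_succ hq₀ hq₁ (m + c),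
    sqrtPoch_succ hq₀ hq₁ m, sqrtPoch_succ hq₀ hq₁ x]
  generalize wallSum _ (m + 1) _ _ = W1 at *
  generalize wallSum _ _ _ _ = W2 at *
  generalize lad q (m + 1 : ℕ) = A at *
  generalize lad q (x + 1 : ℕ) = D at *
  generalize lad q _ = B at *
  field_simp
  ring

end

lemma cg_symm (q : ℝ) (x m n : ℤ) : cg q x m n = cg q x n m := by
  simp only [cg, min_comm m n, abs_sub_comm n m, and_comm (a := 0 ≤ m)]

lemma cg_of_neg_left (q : ℝ) {x : ℤ} (h : x < 0) (m n : ℤ) : cg q x m n = 0 :=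
  if_neg fun h' => by omega

lemma cg_of_neg_mid (q : ℝ) (x : ℤ) {m : ℤ} (h : m < 0) (n : ℤ) : cg q x m n = 0 :=
  if_neg fun h' => by omega

lemma cg_of_neg_right (q : ℝ) (x m : ℤ) {n : ℤ} (h : n < 0) : cg q x m n = 0 :=
  if_neg fun h' => by omega

lemma gam_natCast (q : ℝ) (m : ℕ) : gam q m = q ^ m := by simp [gam]

section

variable {q : ℝ} (hq₀ : 0 < q) (hq₁ : q < 1)
include hq₀ hq₁

lemma lad_ne_zero {x : ℤ} (h : 0 < x) : lad q x ≠ 0 := by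
  obtain ⟨k, rfl⟩ : ∃ k : ℕ, x = (k + 1 : ℕ) := ⟨x.toNat - 1, by omega⟩
  exact (lad_pos hq₀ hq₁ k).ne'

omit hq₁ in
lemma abs_lad_le (x : ℤ) : |lad q x| ≤ 1 := by
  rw [lad, abs_of_nonneg (Real.sqrt_nonneg _), Real.sqrt_le_one]
  have : 0 ≤ (q ^ 2) ^ x.toNat := by positivity
  linarith

omit hq₁ in
lemma gam_pos (x : ℤ) : 0 < gam q x := pow_pos hq₀ _

lemma abs_gam_le (x : ℤ) : |gam q x| ≤ 1 := by
  rw [abs_of_pos (gam_pos hq₀ x)]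
  exact pow_le_one₀ hq₀.le hq₁.le

/-- The eigenvalues q^{2x} of γ*γ are distinct; this separates vectors of different level. -/
lemma gam_sq_injOn {x y : ℤ} (hx : 0 ≤ x) (hy : 0 ≤ y) (h : gam q x ^ 2 = gam q y ^ 2) :
    x = y := by
  have h' := (pow_left_inj₀ (gam_pos hq₀ x).le (gam_pos hq₀ y).le two_ne_zero).1 h
  have := pow_right_injective₀ hq₀ hq₁.ne h'
  omega

/-- The action of `Δ(γ)`. -/
lemma cg_gamma (x m n : ℤ) :
    gam q m * lad q (n + 1) * cg q x m (n + 1) + lad q m * gam q n * cg q x (m - 1) n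
      = gam q x * cg q x m n := by
  by_cases hx : x < 0
  · simp [cg_of_neg_left q hx]
  by_cases hm : m < 0
  · simp [cg_of_neg_mid q x hm, cg_of_neg_mid q x (show m - 1 < 0 by omega)]
  by_cases hn : n < 0
  · rw [cg_of_neg_right q x (m - 1) hn, cg_of_neg_right q x m hn, lad_of_nonpos q (by omega)]
    ring
  lift x to ℕ using by omega
  lift m to ℕ using by omega
  lift n to ℕ using by omega
  -- Passing from C_{x,m,n} to its neighbours changes n - m by one, which raises |n - m| when m ≤ n
  -- and lowers it when m > n.
  rcases le_or_gt m n with h | h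
  · obtain ⟨c, rfl⟩ := Nat.exists_eq_add_of_le h
    rcases m with _ | m
    · have := cgNat_raise_zero hq₀ hq₁ x c
      rw [← cg_natCast hq₀ hq₁, ← cg_natCast hq₀ hq₁] at this
      simp only [Nat.cast_zero, lad_zero, gam_natCast, zero_mul, add_zero] at this ⊢
      rw [← this]
      simp [gam]
    · have := cgNat_raise hq₀ hq₁ x m c
      rw [← cg_natCast hq₀ hq₁, ← cg_natCast hq₀ hq₁, ← cg_natCast hq₀ hq₁] at this
      rw [gam_natCast, gam_natCast, gam_natCast, ← this]
      push_cast
      ring_nf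
  · obtain ⟨c, rfl⟩ := Nat.exists_eq_add_of_lt h
    have := cgNat_lower hq₀ hq₁ x n c
    rw [← cg_natCast hq₀ hq₁, ← cg_natCast hq₀ hq₁, ← cg_natCast hq₀ hq₁] at this
    rw [cg_symm q x _ n, cg_symm q x _ n, cg_symm q x _ (n + 1 : ℤ), gam_natCast, gam_natCast,
      gam_natCast, show ((n + c + 1 : ℕ) : ℤ) - 1 = (n + c : ℕ) by push_cast; ring,
      show n + c + 1 = n + (c + 1) by ring, ← this, show n + (c + 1) = n + 1 + c by ring]
    push_cast
    ring_nf

/-- The action of `Δ(γ*)`. -/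
lemma cg_gamma_star (x m n : ℤ) :
    gam q m * lad q n * cg q x m (n - 1) + lad q (m + 1) * gam q n * cg q x (m + 1) n
      = gam q x * cg q x m n := by
  have := cg_gamma hq₀ hq₁ x n m
  rw [cg_symm q x m n, ← this, cg_symm q x m, cg_symm q x n]
  ring

/-- The action of `Δ(α)`. -/
lemma cg_alpha (x m n : ℤ) :
    lad q (m + 1) * lad q (n + 1) * cg q x (m + 1) (n + 1) - q * gam q m * gam q n * cg q x m n
      = lad q x * cg q (x - 1) m n := by
  wlog h : m ≤ n generalizing m n
  · have := this n m (by omega)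
    rw [cg_symm q x m, cg_symm q (x - 1) m, cg_symm q x (m + 1), ← this]
    ring
  by_cases hx : x < 0
  · simp [cg_of_neg_left q hx, cg_of_neg_left q (show x - 1 < 0 by omega)]
  by_cases hm : m < 0
  · simp [cg_of_neg_mid q _ hm, lad_of_nonpos q (show m + 1 ≤ 0 by omega)]
  lift x to ℕ using by omega
  lift m to ℕ using by omega
  lift n to ℕ using by omega
  obtain ⟨c, rfl⟩ := Nat.exists_eq_add_of_le (show m ≤ n by omega)
  rcases x with _ | x
  · have := cgNat_down_zero hq₀ hq₁ m c
    rw [← cg_natCast hq₀ hq₁, ← cg_natCast hq₀ hq₁] at this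
    rw [Nat.cast_zero, lad_zero, zero_mul, ← this, gam_natCast, gam_natCast]
    push_cast
    ring_nf
  · have := cgNat_down hq₀ hq₁ x m c
    rw [← cg_natCast hq₀ hq₁, ← cg_natCast hq₀ hq₁, ← cg_natCast hq₀ hq₁] at this
    rw [show ((x + 1 : ℕ) : ℤ) - 1 = x by push_cast; ring, ← this, gam_natCast, gam_natCast]
    push_cast
    ring_nf

/-- The action of `Δ(α*)`. -/
lemma cg_alpha_star (x m n : ℤ) :
    lad q m * lad q n * cg q x (m - 1) (n - 1) - q * gam q m * gam q n * cg q x m n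
      = lad q (x + 1) * cg q (x + 1) m n := by
  wlog h : m ≤ n generalizing m n
  · have := this n m (by omega)
    rw [cg_symm q x m, cg_symm q (x + 1) m, cg_symm q x (m - 1), ← this]
    ring
  by_cases hx : x < 0
  · simp [cg_of_neg_left q hx, lad_of_nonpos q (show x + 1 ≤ 0 by omega)]
  by_cases hm : m < 0
  · simp [cg_of_neg_mid q _ hm, lad_of_nonpos q hm.le]
  lift x to ℕ using by omega
  lift m to ℕ using by omega
  lift n to ℕ using by omega
  obtain ⟨c, rfl⟩ := Nat.exists_eq_add_of_le (show m ≤ n by omega)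
  rcases m with _ | m
  · have := cgNat_up_zero hq₀ hq₁ x c
    rw [← cg_natCast hq₀ hq₁, ← cg_natCast hq₀ hq₁] at this
    simp only [Nat.cast_zero, lad_zero, gam_natCast, zero_mul, zero_add] at this ⊢
    push_cast at this
    rw [← this]
    simp [gam]
  · have := cgNat_up hq₀ hq₁ x m c
    rw [← cg_natCast hq₀ hq₁, ← cg_natCast hq₀ hq₁, ← cg_natCast hq₀ hq₁] at this
    rw [gam_natCast, gam_natCast]
    push_cast at this ⊢
    rw [← this, add_sub_cancel_right, show (m : ℤ) + 1 + c - 1 = m + c by ring]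
    ring_nf

end

/-! ### Square summable real functions -/

/-- Square summability of a real function. -/
def SqSummable {ι : Type*} (f : ι → ℝ) : Prop := Summable fun i => f i ^ 2

namespace SqSummable

variable {ι κ : Type*} {f g : ι → ℝ}

lemma mul (hf : SqSummable f) (hg : SqSummable g) : Summable fun i => f i * g i := by
  refine Summable.of_norm_bounded (hf.add hg) fun i => ?_
  rw [Real.norm_eq_abs, abs_mul]
  nlinarith [sq_nonneg (|f i| - |g i|), sq_abs (f i), sq_abs (g i)]

lemma add (hf : SqSummable f) (hg : SqSummable g) : SqSummable fun i => f i + g i := by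
  refine ((Summable.add hf hg).add ((hf.mul hg).mul_left 2)).congr fun i => ?_
  ring

lemma bdd_mul (hf : SqSummable f) {w : ι → ℝ} (hw : ∀ i, |w i| ≤ 1) :
    SqSummable fun i => w i * f i := by
  refine Summable.of_nonneg_of_le (fun i => sq_nonneg _) (fun i => ?_) hf
  rw [mul_pow]
  have : w i ^ 2 ≤ 1 := (sq_le_one_iff_abs_le_one _).2 (hw i)
  nlinarith [sq_nonneg (f i)]

lemma const_mul (hf : SqSummable f) (c : ℝ) : SqSummable fun i => c * f i := by
  refine (Summable.mul_left (c ^ 2) hf).congr fun i => ?_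
  ring

lemma comp (hf : SqSummable f) {e : κ → ι} (he : Function.Injective e) : SqSummable (f ∘ e) :=
  Summable.comp_injective hf he

lemma memℓp (hf : SqSummable f) : Memℓp (fun i => f i : ∀ _ : ι, ℝ) 2 := by
  rw [memℓp_gen_iff (by norm_num)]
  exact hf.congr fun i => by simp

/-- The vector of `ℓ²` with the given coordinates. -/
def vec (hf : SqSummable f) : lp (fun _ : ι => ℝ) 2 := ⟨f, hf.memℓp⟩

lemma inner_vec (hf : SqSummable f) (hg : SqSummable g) :
    inner ℝ hf.vec hg.vec = ∑' i, f i * g i := by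
  rw [lp.inner_eq_tsum]
  refine tsum_congr fun i => ?_
  simp [vec, mul_comm]

lemma inner_vec_single [DecidableEq ι] (hf : SqSummable f) (i : ι) :
    inner ℝ hf.vec (lp.single 2 i (1 : ℝ)) = f i := by
  rw [lp.inner_single_right]
  simp [vec]

end SqSummable

/-! ### Orthonormal families given by their coordinates. -/

section families

variable {ι κ : Type*} [DecidableEq κ] {f : κ → ι → ℝ} (hs : ∀ k, SqSummable (f k))

lemma orthonormal_vec (ho : ∀ k k', ∑' i, f k i * f k' i = if k = k' then 1 else 0) :
    Orthonormal ℝ fun k => (hs k).vec := by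
  rw [orthonormal_iff_ite]
  intro k k'
  rw [SqSummable.inner_vec, ho]

include hs in
/-- Bessel's inequality for the coordinates of an orthonormal family. -/
lemma bessel_coord (ho : ∀ k k', ∑' i, f k i * f k' i = if k = k' then 1 else 0) (i : ι) :
    SqSummable (fun k => f k i) ∧ ∑' k, f k i ^ 2 ≤ 1 := by
  classical
  have h := orthonormal_vec hs ho
  have h1 := h.inner_products_summable (lp.single 2 i (1 : ℝ))
  have h2 := h.tsum_inner_products_le (lp.single 2 i (1 : ℝ))
  simp only [SqSummable.inner_vec_single, Real.norm_eq_abs, sq_abs] at h1 h2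
  rw [lp.norm_single (by norm_num)] at h2
  exact ⟨h1, by simpa using h2⟩

include hs in
/-- Bessel's inequality. -/
lemma bessel (ho : ∀ k k', ∑' i, f k i * f k' i = if k = k' then 1 else 0) {g : ι → ℝ}
    (hg : SqSummable g) :
    SqSummable (fun k => ∑' i, f k i * g i) ∧ ∑' k, (∑' i, f k i * g i) ^ 2 ≤ ∑' i, g i ^ 2 := by
  have h := orthonormal_vec hs ho
  have h1 := h.inner_products_summable hg.vec
  have h2 := h.tsum_inner_products_le hg.vec
  simp only [SqSummable.inner_vec, Real.norm_eq_abs, sq_abs] at h1 h2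
  rw [← real_inner_self_eq_norm_sq, SqSummable.inner_vec] at h2
  exact ⟨h1, by simpa [sq] using h2⟩

include hs in
/-- An orthonormal family whose coordinates satisfy Parseval's equality expands every square
summable function pointwise. -/
lemma hasSum_of_parseval (ho : ∀ k k', ∑' i, f k i * f k' i = if k = k' then 1 else 0) {i : ι}
    (hi : ∑' k, f k i ^ 2 = 1) {g : ι → ℝ} (hg : SqSummable g) :
    HasSum (fun k => (∑' j, f k j * g j) * f k i) (g i) := by
  classical
  have h := orthonormal_vec hs ho
  have hb := (bessel_coord hs ho i).1
  have hsum : Summable fun k => f k i • (hs k).vec := by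
    have := h.orthogonalFamily.summable_iff_norm_sq_summable (f := fun k => f k i)
    simp only [Real.norm_eq_abs, sq_abs, LinearIsometry.toSpanSingleton_apply] at this
    exact this.2 hb
  -- W is the projection of the basis vector at i onto the closed span. Parseval's equality gives
  -- ‖W‖² = 1, which is also the inner product of W with that unit vector, so the two are equal.
  obtain ⟨W, hW⟩ := hsum
  have h1 : ∀ k, inner ℝ (hs k).vec W = f k i := by
    intro k
    have h2 := (innerSL ℝ (hs k).vec).hasSum hW
    have h3 := hasSum_ite_eq k (f k i)
    refine h2.unique (h3.congr_fun fun k' => ?_)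
    rw [innerSL_apply_apply, inner_smul_right, SqSummable.inner_vec, ho]
    by_cases hk : k' = k
    · subst hk; simp
    · simp [hk, Ne.symm hk]
  have h2 : ∀ V : lp (fun _ : ι => ℝ) 2, (∀ k, inner ℝ V (hs k).vec = f k i) →
      inner ℝ V W = 1 := by
    intro V hV
    have h2 := (innerSL ℝ V).hasSum hW
    simp only [innerSL_apply_apply, inner_smul_right, hV] at h2
    rw [← h2.tsum_eq, ← hi]
    exact tsum_congr fun k => (sq _).symm
  have h3 : W = lp.single 2 i (1 : ℝ) := by
    have e1 := h2 W fun k => by rw [real_inner_comm, h1]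
    have e2 := h2 (lp.single 2 i (1 : ℝ)) fun k => by
      rw [real_inner_comm, SqSummable.inner_vec_single]
    have e3 : inner ℝ (lp.single 2 i (1 : ℝ) : lp (fun _ : ι => ℝ) 2)
        (lp.single 2 i (1 : ℝ)) = 1 := by
      rw [real_inner_self_eq_norm_sq, lp.norm_single (by norm_num)]; simp
    rw [← sub_eq_zero, ← inner_self_eq_zero (𝕜 := ℝ), inner_sub_left, inner_sub_right,
      inner_sub_right, e1, e2, real_inner_comm, e2, e3]
    norm_num
  have h4 := (innerSL ℝ hg.vec).hasSum hW
  rw [h3] at h4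
  simp only [innerSL_apply_apply, inner_smul_right, SqSummable.inner_vec,
    SqSummable.inner_vec_single] at h4
  refine h4.congr_fun fun k => ?_
  rw [mul_comm]
  simp only [mul_comm]

end families

section adjoint

variable {A : Type*} [AddCommGroup A] {n : ℕ} {w : Fin n → A → ℝ} (hw : ∀ j v, |w j v| ≤ 1)
  (s : Fin n → A) {F H : A → ℝ} (hF : SqSummable F) (hH : SqSummable H)
include hw hF hH

/-- The adjoint of a weighted sum of translations. -/
lemma tsum_shift_adjoint :
    ∑' v, (∑ j, w j v * F (v + s j)) * H v
      = ∑' v, F v * ∑ j, w j (v - s j) * H (v - s j) := by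
  have hL : ∀ j, Summable fun v => w j v * F (v + s j) * H v := fun j =>
    (SqSummable.bdd_mul (hF.comp (add_left_injective (s j))) (hw j)).mul hH
  have hR : ∀ j, Summable fun v => F v * (w j (v - s j) * H (v - s j)) := fun j =>
    hF.mul (SqSummable.bdd_mul (hH.comp (sub_left_injective (b := s j))) fun v => hw j _)
  simp only [Finset.sum_mul, Finset.mul_sum]
  rw [Summable.tsum_finsetSum fun j _ => hL j, Summable.tsum_finsetSum fun j _ => hR j]
  refine Finset.sum_congr rfl fun j _ => ?_
  rw [← (Equiv.addRight (s j)).tsum_eq fun v => F v * (w j (v - s j) * H (v - s j))]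
  refine tsum_congr fun v => ?_
  simp only [Equiv.coe_addRight, add_sub_cancel_right]
  ring

end adjoint

/-! ### Orthogonality of the Clebsch--Gordan coefficients -/

lemma tsum_int_eq_tsum_nat {f : ℤ → ℝ} (hf : ∀ x < 0, f x = 0) : ∑' x, f x = ∑' x : ℕ, f x := by
  refine (Function.Injective.tsum_eq Nat.cast_injective fun x hx => ?_).symm
  by_contra h
  refine hx (hf x ?_)
  by_contra h'
  exact h ⟨x.toNat, by simp; omega⟩

lemma summable_int_iff_nat {f : ℤ → ℝ} (hf : ∀ x < 0, f x = 0) :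
    Summable f ↔ Summable fun x : ℕ => f x := by
  refine (Function.Injective.summable_iff Nat.cast_injective fun x hx => hf x ?_).symm
  by_contra h'
  exact hx ⟨x.toNat, by simp; omega⟩

section

variable {q : ℝ} (hq₀ : 0 < q) (hq₁ : q < 1)
include hq₀ hq₁

omit hq₀ hq₁ in
lemma qPochInf_le_qPoch {t : ℝ} (h0 : 0 < t) (h1 : t < 1) (n : ℕ) :
    qPochInf t t ≤ qPoch t t n := by
  have : Antitone (qPoch t t) := antitone_nat_of_succ_le fun n => by
    rw [qPoch_self_succ]
    have := qPoch_self_pos h0 h1 n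
    have : 0 < t ^ (n + 1) := by positivity
    nlinarith
  exact this.le_of_tendsto (tendsto_qPoch h0 h1 t) n

/-- For m = 0 the Wall polynomial is 1, so the entry is explicit. This is the only place where
actual values of C enter the orthogonality proofs. -/
lemma cg_zero_sq (x c : ℕ) : cg q x 0 c ^ 2 =
    (q ^ 2) ^ ((c + 1) * x) * (qPochInf (q ^ 2) (q ^ 2) /
      (qPoch (q ^ 2) (q ^ 2) c * qPoch (q ^ 2) (q ^ 2) x)) := by
  obtain ⟨h0, h1⟩ := sq_pos_lt_one hq₀ hq₁
  have := cg_natCast hq₀ hq₁ x 0 c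
  simp only [zero_add, Nat.cast_zero] at this
  have hs := Real.sq_sqrt (qPochInf_self_pos h0 h1).le
  have b1 := sqrtPoch_pos hq₀ hq₁ c
  have b2 := sqrtPoch_pos hq₀ hq₁ x
  have b3 : sqrtPoch q 0 = 1 := by simp [sqrtPoch, qPoch_zero]
  have b4 : wallSum (q ^ 2) 0 c ((q ^ 2) ^ (x + 1)) = 1 / sqrtPoch q c ^ 2 := by
    rw [sqrtPoch_sq hq₀ hq₁]; simp [wallSum, wallCoeff, qPoch_zero]
  have b5 : ((-1 : ℝ) ^ x) ^ 2 = 1 := by rw [← pow_mul, mul_comm, pow_mul]; simp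
  rw [this, cgNat, b4, ← sqrtPoch_sq hq₀ hq₁, ← sqrtPoch_sq hq₀ hq₁, b3]
  simp only [mul_pow, div_pow, zero_add, b5, hs]
  field_simp
  ring

/-- The bound is uniform in c and summable in x: it is the dominating function in
`colGram_zero_zero`. -/
lemma cg_zero_sq_le (x c : ℕ) :
    cg q x 0 c ^ 2 ≤ (q ^ 2) ^ x / qPochInf (q ^ 2) (q ^ 2) := by
  obtain ⟨h0, h1⟩ := sq_pos_lt_one hq₀ hq₁
  rw [cg_zero_sq hq₀ hq₁]
  have h := qPochInf_self_pos h0 h1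
  have e1 := qPochInf_le_qPoch h0 h1 c
  have e2 := qPochInf_le_qPoch h0 h1 x
  have p1 := qPoch_self_pos h0 h1 c
  have p2 := qPoch_self_pos h0 h1 x
  rw [div_eq_mul_one_div ((q ^ 2) ^ x)]
  refine mul_le_mul (pow_le_pow_of_le_one h0.le h1.le (by nlinarith)) ?_ (by positivity)
    (by positivity)
  rw [div_le_div_iff₀ (by positivity) h]
  nlinarith

lemma tendsto_cg_zero_sq (x : ℕ) :
    Filter.Tendsto (fun c : ℕ => cg q x 0 c ^ 2) Filter.atTop (nhds (if x = 0 then 1 else 0)) := by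
  obtain ⟨h0, h1⟩ := sq_pos_lt_one hq₀ hq₁
  have hI := (qPochInf_self_pos h0 h1)
  simp only [cg_zero_sq hq₀ hq₁]
  have hx := qPoch_self_pos h0 h1 x
  have h2 : Filter.Tendsto (fun c => qPochInf (q ^ 2) (q ^ 2) /
      (qPoch (q ^ 2) (q ^ 2) c * qPoch (q ^ 2) (q ^ 2) x)) Filter.atTop
      (nhds (qPochInf (q ^ 2) (q ^ 2) /
      (qPochInf (q ^ 2) (q ^ 2) * qPoch (q ^ 2) (q ^ 2) x))) :=
    tendsto_const_nhds.div ((tendsto_qPoch h0 h1 (q ^ 2)).mul_const _) (by positivity)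
  rcases x with _ | x
  · simp only [mul_zero, pow_zero, one_mul, qPoch_zero, mul_one, if_true] at h2 ⊢
    rwa [div_self hI.ne'] at h2
  · have h3 : Filter.Tendsto (fun c : ℕ => (q ^ 2) ^ ((c + 1) * (x + 1))) Filter.atTop
        (nhds 0) := by
      refine (tendsto_pow_atTop_nhds_zero_of_lt_one h0.le h1).comp ?_
      exact Filter.tendsto_atTop_mono (fun c => by nlinarith : ∀ c : ℕ, c ≤ (c + 1) * (x + 1))
        Filter.tendsto_id
    have := h3.mul h2
    simpa using this

/-- The relation for γ* expresses column m + 1 through columns with first index m, with coefficients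
bounded in x. -/
lemma sqSummable_col (m : ℕ) : ∀ n : ℤ, SqSummable fun x : ℤ => cg q x m n := by
  induction m with
  | zero =>
    intro n
    by_cases hn : n < 0
    · simp only [cg_of_neg_right q _ _ hn, SqSummable]
      simp
    lift n to ℕ using by omega
    obtain ⟨h0, h1⟩ := sq_pos_lt_one hq₀ hq₁
    refine (summable_int_iff_nat fun x hx => by simp [cg_of_neg_left q hx]).2 ?_
    exact Summable.of_nonneg_of_le (fun _ => sq_nonneg _) (fun x => cg_zero_sq_le hq₀ hq₁ x n)
      ((summable_geometric_of_lt_one h0.le h1).div_const _)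
  | succ m ih =>
    intro n
    have h1 := (ih n).bdd_mul (w := gam q) (abs_gam_le hq₀ hq₁)
    have h2 := (ih (n - 1)).const_mul (-(gam q m * lad q n))
    have h3 := (h1.add h2).const_mul (lad q (m + 1) * gam q n)⁻¹
    have h4 : lad q (m + 1) * gam q n ≠ 0 :=
      mul_ne_zero (lad_ne_zero hq₀ hq₁ (by omega)) (gam_pos hq₀ _).ne'
    convert h3 using 2 with x
    rw [eq_inv_mul_iff_mul_eq₀ h4, ← cg_gamma_star hq₀ hq₁]
    push_cast
    ring

lemma sqSummable_cg (m n : ℤ) : SqSummable fun x : ℤ => cg q x m n := by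
  by_cases hm : m < 0
  · simp only [cg_of_neg_mid q _ hm, SqSummable]
    simp
  lift m to ℕ using by omega
  exact sqSummable_col hq₀ hq₁ m n

/-- The Gram matrix of the columns of the Clebsch--Gordan matrix. -/
def colGram (q : ℝ) (c m m' : ℤ) : ℝ := ∑' x : ℤ, cg q x m (m + c) * cg q x m' (m' + c)

omit hq₀ hq₁ in
lemma colGram_symm (c m m' : ℤ) : colGram q c m m' = colGram q c m' m :=
  tsum_congr fun _ => mul_comm _ _

/-- The weighted shift in x on one column is transferred to the other; `cg_alpha` and
`cg_alpha_star` rewrite both sides as combinations of neighbouring columns. -/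
lemma colGram_rec (c m m' : ℤ) :
    lad q (m + 1) * lad q (m + c + 1) * colGram q c (m + 1) m' =
      q * (gam q m * gam q (m + c) - gam q m' * gam q (m' + c)) * colGram q c m m' +
        lad q m' * lad q (m' + c) * colGram q c m (m' - 1) := by
  have hS := fun m m' => (sqSummable_cg hq₀ hq₁ m (m + c)).mul (sqSummable_cg hq₀ hq₁ m' (m' + c))
  have key := tsum_shift_adjoint (A := ℤ) (n := 1) (w := fun _ => lad q)
    (fun _ => abs_lad_le hq₀) (fun _ => -1) (sqSummable_cg hq₀ hq₁ m (m + c))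
    (sqSummable_cg hq₀ hq₁ m' (m' + c))
  simp only [Fin.sum_univ_one, ← sub_eq_add_neg, sub_neg_eq_add, ← cg_alpha hq₀ hq₁,
    ← cg_alpha_star hq₀ hq₁] at key
  have e1 : HasSum (fun v => (lad q (m + 1) * lad q (m + c + 1) * cg q v (m + 1) (m + c + 1) -
      q * gam q m * gam q (m + c) * cg q v m (m + c)) * cg q v m' (m' + c))
      (lad q (m + 1) * lad q (m + c + 1) * colGram q c (m + 1) m'
       - q * gam q m * gam q (m + c) * colGram q c m m') := by
    refine (((hS (m + 1) m').hasSum.mul_left (lad q (m + 1) * lad q (m + c + 1))).sub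
      ((hS m m').hasSum.mul_left (q * gam q m * gam q (m + c)))).congr_fun fun x => ?_
    rw [show m + 1 + c = m + c + 1 by ring]
    ring
  have e2 : HasSum (fun v => cg q v m (m + c) * (lad q m' * lad q (m' + c) *
      cg q v (m' - 1) (m' + c - 1) - q * gam q m' * gam q (m' + c) * cg q v m' (m' + c)))
      (lad q m' * lad q (m' + c) * colGram q c m (m' - 1)
       - q * gam q m' * gam q (m' + c) * colGram q c m m') := by
    refine (((hS m (m' - 1)).hasSum.mul_left (lad q m' * lad q (m' + c))).sub
      ((hS m m').hasSum.mul_left (q * gam q m' * gam q (m' + c)))).congr_fun fun x => ?_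
    rw [show m' - 1 + c = m' + c - 1 by ring]
    ring
  rw [e1.tsum_eq, e2.tsum_eq] at key
  linear_combination key

lemma lad_mul_lad_ne_zero (m c : ℕ) : lad q (m + 1) * lad q (m + c + 1) ≠ 0 :=
  mul_ne_zero (lad_ne_zero hq₀ hq₁ (by omega)) (lad_ne_zero hq₀ hq₁ (by omega))

lemma colGram_one_zero (c : ℕ) : colGram q c 1 0 = 0 := by
  have := colGram_rec hq₀ hq₁ c 0 0
  rw [lad_zero, sub_self] at this
  have h := lad_mul_lad_ne_zero hq₀ hq₁ 0 c
  push_cast at h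
  refine (mul_eq_zero.1 (?_ : lad q (0 + 1) * lad q (0 + c + 1) * colGram q c 1 0 = 0)).resolve_left h
  rw [zero_add (1 : ℤ)] at this ⊢
  rw [this]
  ring

/-- The sum ∑ q^x C_{x,0,c} C_{x,0,c+1} is evaluated twice, with q^x absorbed into one factor by γ
or into the other by γ*. The extra term is `colGram q c 1 0`, which is zero. -/
lemma colGram_zero_zero_succ (c : ℕ) : colGram q (c + 1 : ℕ) 0 0 = colGram q c 0 0 := by
  have hS := fun m n m' n' => (sqSummable_cg hq₀ hq₁ m n).mul (sqSummable_cg hq₀ hq₁ m' n')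
  have e1 : ∀ x : ℤ, lad q (c + 1) * cg q x 0 (c + 1) = gam q x * cg q x 0 c := by
    intro x
    rw [← cg_gamma hq₀ hq₁, lad_zero]
    simp [gam]
  have e2 : ∀ x : ℤ, lad q (c + 1) * cg q x 0 c + lad q 1 * gam q (c + 1) * cg q x 1 (c + 1)
      = gam q x * cg q x 0 (c + 1) := by
    intro x
    rw [← cg_gamma_star hq₀ hq₁]
    simp [gam]
  have h1 : HasSum (fun x : ℤ => lad q (c + 1) * (cg q x 0 (c + 1) * cg q x 0 (c + 1)))
      (lad q (c + 1) * colGram q (c + 1 : ℕ) 0 0) := by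
    have := (hS 0 (c + 1) 0 (c + 1)).hasSum.mul_left (lad q (c + 1))
    simpa [colGram] using this
  have h2 : HasSum (fun x : ℤ => lad q (c + 1) * (cg q x 0 (c + 1) * cg q x 0 (c + 1)))
      (lad q (c + 1) * colGram q c 0 0 + lad q 1 * gam q (c + 1) * colGram q c 1 0) := by
    have := ((hS 0 c 0 c).hasSum.mul_left (lad q (c + 1))).add
      ((hS 1 (c + 1) 0 c).hasSum.mul_left (lad q 1 * gam q (c + 1)))
    have e3 : lad q (c + 1) * colGram q c 0 0 + lad q 1 * gam q (c + 1) * colGram q c 1 0 =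
        lad q (c + 1) * ∑' x : ℤ, cg q x 0 c * cg q x 0 c +
          lad q 1 * gam q (c + 1) * ∑' x : ℤ, cg q x 1 (c + 1) * cg q x 0 c := by
      simp only [colGram, zero_add, add_comm (1 : ℤ)]
    rw [e3]
    refine this.congr_fun fun x => ?_
    linear_combination cg q x 0 (c + 1) * e1 x - cg q x 0 c * e2 x
  rw [colGram_one_zero hq₀ hq₁, mul_zero, add_zero] at h2
  exact mul_left_cancel₀ (lad_ne_zero hq₀ hq₁ (by omega)) (h1.unique h2)

/-- The value does not depend on c, and as c → ∞ the squared entries tend, dominatedly, to the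
indicator of x = 0. -/
lemma colGram_zero_zero (c : ℕ) : colGram q c 0 0 = 1 := by
  obtain ⟨h0, h1⟩ := sq_pos_lt_one hq₀ hq₁
  have hc : ∀ c : ℕ, colGram q c 0 0 = colGram q (0 : ℕ) 0 0 := by
    intro c
    induction c with
    | zero => rfl
    | succ c ih => rw [colGram_zero_zero_succ hq₀ hq₁, ih]
  have e : ∀ c : ℕ, colGram q c 0 0 = ∑' x : ℕ, cg q x 0 c ^ 2 := by
    intro c
    rw [colGram, tsum_int_eq_tsum_nat fun x hx => by simp [cg_of_neg_left q hx]]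
    simp [sq]
  have lim := tendsto_tsum_of_dominated_convergence
    ((summable_geometric_of_lt_one h0.le h1).div_const (qPochInf (q ^ 2) (q ^ 2)))
    (tendsto_cg_zero_sq hq₀ hq₁) (Filter.Eventually.of_forall fun c x => by
      rw [Real.norm_eq_abs, abs_of_nonneg (sq_nonneg _)]
      exact cg_zero_sq_le hq₀ hq₁ x c)
  simp only [← e, tsum_ite_eq] at lim
  rw [hc]
  exact tendsto_nhds_unique (tendsto_const_nhds.congr fun c => (hc c).symm) lim

lemma colGram_succ_zero (c m : ℕ) : colGram q c (m + 1 : ℕ) 0 = 0 := by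
  induction m with
  | zero => simpa using colGram_one_zero hq₀ hq₁ c
  | succ m ih =>
    have := colGram_rec hq₀ hq₁ c (m + 1 : ℕ) 0
    rw [lad_zero, ih] at this
    refine (mul_eq_zero.1 ?_).resolve_left (lad_mul_lad_ne_zero hq₀ hq₁ (m + 1) c)
    push_cast at this ⊢
    rw [this]
    ring

/-- Double induction through `colGram_rec`: the bracket of the first term vanishes when its Gram
entry is 1, and on the diagonal the second term carries the same coefficient as the left side. -/
lemma colGram_eq (c m' : ℕ) : ∀ m : ℕ, colGram q c m m' = if m = m' then 1 else 0 := by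
  induction m' with
  | zero =>
    rintro (_ | m)
    · simpa using colGram_zero_zero hq₀ hq₁ c
    · simpa using colGram_succ_zero hq₀ hq₁ c m
  | succ m' ih' =>
    intro m
    induction m with
    | zero =>
      rw [colGram_symm]
      simpa using colGram_succ_zero hq₀ hq₁ c m'
    | succ m ih =>
      have := colGram_rec hq₀ hq₁ c m (m' + 1 : ℕ)
      rw [ih, show ((m' + 1 : ℕ) : ℤ) - 1 = m' by push_cast; ring, ih'] at this
      refine mul_left_cancel₀ (lad_mul_lad_ne_zero hq₀ hq₁ m c) ?_
      push_cast at this ⊢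
      rw [this]
      by_cases h1 : m = m' + 1
      · subst h1; simp
      · by_cases h2 : m = m'
        · subst h2
          rw [show (m : ℤ) + 1 + c = m + c + 1 by ring]
          simp
        · simp [h1, h2]

open Classical in
/-- Orthogonality of the columns of the Clebsch--Gordan matrix. -/
lemma tsum_cg_mul_cg_col (p m m' : ℤ) :
    ∑' x : ℤ, cg q x (m - p) m * cg q x (m' - p) m' =
      if m = m' ∧ 0 ≤ m ∧ 0 ≤ m - p then 1 else 0 := by
  by_cases h : 0 ≤ m ∧ 0 ≤ m - p
  swap
  · rw [if_neg (by tauto)]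
    have : ∀ x, cg q x (m - p) m = 0 := fun x => if_neg (by tauto)
    simp [this]
  by_cases h' : 0 ≤ m' ∧ 0 ≤ m' - p
  swap
  · rw [if_neg (by rintro ⟨rfl, h''⟩; exact h' h'')]
    have : ∀ x, cg q x (m' - p) m' = 0 := fun x => if_neg (by tauto)
    simp [this]
  simp only [show (m = m' ∧ 0 ≤ m ∧ 0 ≤ m - p) ↔ m = m' by tauto]
  rcases le_or_gt 0 p with hp | hp
  · have := colGram_eq hq₀ hq₁ p.toNat (m' - p).toNat (m - p).toNat
    rw [colGram, Int.toNat_of_nonneg hp, Int.toNat_of_nonneg h.2, Int.toNat_of_nonneg h'.2,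
      sub_add_cancel, sub_add_cancel] at this
    rw [this]
    congr 1
    rw [eq_iff_iff]
    omega
  · have := colGram_eq hq₀ hq₁ (-p).toNat m'.toNat m.toNat
    rw [colGram, Int.toNat_of_nonneg (show 0 ≤ -p by omega), Int.toNat_of_nonneg h.1,
      Int.toNat_of_nonneg h'.1, ← sub_eq_add_neg, ← sub_eq_add_neg] at this
    simp only [cg_symm q _ (m - p), cg_symm q _ (m' - p), this]
    congr 1
    rw [eq_iff_iff]
    omega

/-! ### Orthogonality of the rows -/

/-- Bessel: a matrix with orthonormal columns has rows of norm at most 1. -/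
lemma sqSummable_row_and_le (x p : ℤ) :
    SqSummable (fun m : ℤ => cg q x (m - p) m) ∧ ∑' m : ℤ, cg q x (m - p) m ^ 2 ≤ 1 := by
  classical
  let κ := {m : ℤ // 0 ≤ m ∧ 0 ≤ m - p}
  have h := bessel_coord (κ := κ) (f := fun m x => cg q x (m.1 - p) m.1)
    (fun m => sqSummable_cg hq₀ hq₁ _ _) (fun m m' => by
      rw [tsum_cg_mul_cg_col hq₀ hq₁]
      have := m.2
      by_cases hm : m = m'
      · subst hm; rw [if_pos ⟨rfl, this⟩, if_pos rfl]
      · simp [hm, Subtype.coe_inj]) x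
  have hz : ∀ m, m ∉ Set.range (Subtype.val : κ → ℤ) → cg q x (m - p) m ^ 2 = 0 := by
    intro m hm
    rw [Subtype.range_coe_subtype, Set.mem_ofPred_eq] at hm
    rw [cg, if_neg (by tauto)]
    simp
  refine ⟨(Function.Injective.summable_iff Subtype.val_injective hz).1 h.1, ?_⟩
  rw [← Function.Injective.tsum_eq (g := (Subtype.val : κ → ℤ)) Subtype.val_injective]
  · exact h.2
  · exact fun m hm => by_contra fun hm' => hm (hz m hm')

/-- The Gram matrix of the rows of the Clebsch--Gordan matrix. -/
def rowGram (q : ℝ) (x x' p : ℤ) : ℝ := ∑' m : ℤ, cg q x (m - p) m * cg q x' (m - p) m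

omit hq₀ hq₁ in
lemma rowGram_symm (x x' p : ℤ) : rowGram q x x' p = rowGram q x' x p :=
  tsum_congr fun _ => mul_comm _ _

omit hq₀ hq₁ in
lemma abs_mul_le_one {a b : ℝ} (ha : |a| ≤ 1) (hb : |b| ≤ 1) : |a * b| ≤ 1 := by
  rw [abs_mul]; exact mul_le_one₀ ha (abs_nonneg _) hb

/-- γ sends the row (x,p) to q^x times the row (x,p-1), and its adjoint sends (x',p-1) to q^{x'}
times (x',p). -/
lemma gam_mul_rowGram (x x' p : ℤ) :
    gam q x * rowGram q x x' (p - 1) = gam q x' * rowGram q x x' p := by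
  have hs := fun x p => (sqSummable_row_and_le hq₀ hq₁ x p).1
  have key := tsum_shift_adjoint (A := ℤ) (n := 2)
    (w := ![fun m => gam q (m - p + 1) * lad q (m + 1), fun m => lad q (m - p + 1) * gam q m])
    (by
      intro j v
      have h1 := fun x => abs_lad_le (q := q) hq₀ x
      have h2 := abs_gam_le hq₀ hq₁
      fin_cases j <;> exact abs_mul_le_one (by simp [h1, h2]) (by simp [h1, h2]))
    ![1, 0] (hs x p) (hs x' (p - 1))
  simp only [Fin.sum_univ_two, Matrix.cons_val_zero, Matrix.cons_val_one, add_zero, sub_zero] at key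
  have e1 : ∀ m : ℤ, gam q (m - p + 1) * lad q (m + 1) * cg q x (m + 1 - p) (m + 1) +
      lad q (m - p + 1) * gam q m * cg q x (m - p) m = gam q x * cg q x (m - (p - 1)) m := by
    intro m
    have := cg_gamma hq₀ hq₁ x (m - p + 1) m
    rw [show m - (p - 1) = m - p + 1 by ring, ← this]
    ring_nf
  have e2 : ∀ m : ℤ, gam q (m - 1 - p + 1) * lad q (m - 1 + 1) * cg q x' (m - 1 - (p - 1)) (m - 1) +
      lad q (m - p + 1) * gam q m * cg q x' (m - (p - 1)) m = gam q x' * cg q x' (m - p) m := by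
    intro m
    rw [← cg_gamma_star hq₀ hq₁]
    ring_nf
  simp only [e1, e2] at key
  rw [rowGram, rowGram, ← tsum_mul_left, ← tsum_mul_left]
  refine Eq.trans (tsum_congr fun m => ?_) (key.trans (tsum_congr fun m => ?_)) <;> ring

/-- Using `gam_mul_rowGram` in both orders gives (q^{2x} - q^{2x'}) times the Gram entry equal to 0.
-/
lemma rowGram_eq_zero {x x' : ℤ} (hx : 0 ≤ x) (hx' : 0 ≤ x') (h : x ≠ x') (p : ℤ) :
    rowGram q x x' p = 0 := by
  have h1 := gam_mul_rowGram hq₀ hq₁ x x' p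
  have h2 := gam_mul_rowGram hq₀ hq₁ x' x p
  rw [rowGram_symm, rowGram_symm x' x] at h2
  have h3 : (gam q x ^ 2 - gam q x' ^ 2) * rowGram q x x' p = 0 := by
    linear_combination gam q x' * h1 - gam q x * h2
  refine (mul_eq_zero.1 h3).resolve_left fun h4 => h ?_
  exact gam_sq_injOn hq₀ hq₁ hx hx' (sub_eq_zero.1 h4)

lemma rowGram_self_pred (x p : ℤ) : rowGram q x x (p - 1) = rowGram q x x p :=
  mul_left_cancel₀ (gam_pos hq₀ x).ne' (gam_mul_rowGram hq₀ hq₁ x x p)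

lemma rowGram_self_eq_nat (x p : ℤ) (c : ℕ) : rowGram q x x (p + c) = rowGram q x x p := by
  induction c with
  | zero => simp
  | succ c ih =>
    rw [← ih, ← rowGram_self_pred hq₀ hq₁ x (p + (c + 1 : ℕ))]
    congr 1
    push_cast
    ring

lemma lad_mul_rowGram (x p : ℤ) :
    lad q x * rowGram q (x - 1) (x - 1) p = lad q x * rowGram q x x p := by
  have hs := fun x => (sqSummable_row_and_le hq₀ hq₁ x p).1
  have key := tsum_shift_adjoint (A := ℤ) (n := 2)
    (w := ![fun m => lad q (m - p + 1) * lad q (m + 1), fun m => - (q * gam q (m - p) * gam q m)])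
    (by
      intro j v
      have h1 := fun x => abs_lad_le (q := q) hq₀ x
      have h2 := abs_gam_le hq₀ hq₁
      have h3 : |q| ≤ 1 := by rw [abs_of_pos hq₀]; exact hq₁.le
      fin_cases j
      · exact abs_mul_le_one (h1 _) (h1 _)
      · simp only [Fin.mk_one, Matrix.cons_val_one, Matrix.cons_val_fin_one, abs_neg]
        exact abs_mul_le_one (abs_mul_le_one h3 (h2 _)) (h2 _))
    ![1, 0] (hs x) (hs (x - 1))
  simp only [Fin.sum_univ_two, Matrix.cons_val_zero, Matrix.cons_val_one, add_zero, sub_zero] at key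
  have e1 : ∀ m : ℤ, lad q (m - p + 1) * lad q (m + 1) * cg q x (m + 1 - p) (m + 1) +
      -(q * gam q (m - p) * gam q m) * cg q x (m - p) m = lad q x * cg q (x - 1) (m - p) m := by
    intro m
    rw [← cg_alpha hq₀ hq₁]
    ring_nf
  have e2 : ∀ m : ℤ, lad q (m - 1 - p + 1) * lad q (m - 1 + 1) * cg q (x - 1) (m - 1 - p) (m - 1) +
      -(q * gam q (m - p) * gam q m) * cg q (x - 1) (m - p) m = lad q x * cg q x (m - p) m := by
    intro m
    have := cg_alpha_star hq₀ hq₁ (x - 1) (m - p) m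
    rw [sub_add_cancel] at this
    rw [← this]
    ring_nf
  simp only [e1, e2] at key
  rw [rowGram, rowGram, ← tsum_mul_left, ← tsum_mul_left]
  refine Eq.trans (tsum_congr fun m => ?_) (key.trans (tsum_congr fun m => ?_)) <;> ring

/-- The ladder α reduces to x = 0, where Bessel gives ≤ 1. For ≥ 1, the value does not depend on p,
so it dominates C_{0,0,c}² for every c, and these squares tend to 1. -/
lemma rowGram_self {x : ℤ} (hx : 0 ≤ x) (p : ℤ) : rowGram q x x p = 1 := by
  lift x to ℕ using hx
  induction x with
  | succ x ih =>
    have := mul_left_cancel₀ (lad_ne_zero hq₀ hq₁ (by omega))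
      (lad_mul_rowGram hq₀ hq₁ (x + 1 : ℕ) p)
    rw [← this, ← ih]
    simp
  | zero =>
    refine le_antisymm ?_ ?_
    · simpa [rowGram, sq] using (sqSummable_row_and_le hq₀ hq₁ 0 p).2
    · have h0 : ∀ c : ℕ, rowGram q 0 0 p = rowGram q 0 0 c := by
        intro c
        rcases le_total p c with h | h
        · rw [show (c : ℤ) = p + (c - p).toNat by omega, rowGram_self_eq_nat hq₀ hq₁]
        · rw [show p = c + (p - c).toNat by omega, rowGram_self_eq_nat hq₀ hq₁]
      refine le_of_tendsto' (tendsto_cg_zero_sq hq₀ hq₁ 0) fun c => ?_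
      rw [Nat.cast_zero, h0 c]
      have hs := (sqSummable_row_and_le hq₀ hq₁ 0 c).1
      have := hs.le_tsum (c : ℤ) fun _ _ => sq_nonneg _
      simpa [rowGram, sq] using this

open Classical in
/-- Orthogonality of the rows of the Clebsch--Gordan matrix. -/
lemma tsum_cg_mul_cg_row (x x' p : ℤ) :
    ∑' m : ℤ, cg q x (m - p) m * cg q x' (m - p) m = if x = x' ∧ 0 ≤ x then 1 else 0 := by
  by_cases hx : 0 ≤ x
  swap
  · simp [cg_of_neg_left q (not_le.1 hx), hx]
  by_cases hx' : 0 ≤ x'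
  swap
  · rw [if_neg (by rintro ⟨rfl, h⟩; exact hx' h)]
    simp [cg_of_neg_left q (not_le.1 hx')]
  by_cases h : x = x'
  · subst h
    simpa [hx, rowGram] using rowGram_self hq₀ hq₁ hx p
  · simpa [h, rowGram] using rowGram_eq_zero hq₀ hq₁ hx hx' h p

end

/-! ### Orthonormality of the tree vectors -/

section prod

variable {α β : Type*} {a b : α → ℝ} {f h : α → β → ℝ}

/-- This is the shape of a tree vector with one leaf split off: a row of C times a vector of norm at
most 1 depending on the leaf's index. -/
lemma SqSummable.prod (ha : SqSummable a) (hf : ∀ i, SqSummable (f i))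
    (hf1 : ∀ i, ∑' w, f i w ^ 2 ≤ 1) : SqSummable fun z : α × β => a z.1 * f z.1 z.2 := by
  refine (summable_prod_of_nonneg fun z => sq_nonneg _).2 ⟨fun i => ?_, ?_⟩
  · exact (hf i).const_mul (a i)
  · refine Summable.of_nonneg_of_le (fun i => tsum_nonneg fun w => sq_nonneg _) (fun i => ?_) ha
    simp only [mul_pow, tsum_mul_left]
    exact mul_le_of_le_one_right (sq_nonneg _) (hf1 i)

lemma tsum_prod_mul (hF : SqSummable fun z : α × β => a z.1 * f z.1 z.2)
    (hH : SqSummable fun z : α × β => b z.1 * h z.1 z.2) :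
    ∑' z : α × β, a z.1 * f z.1 z.2 * (b z.1 * h z.1 z.2)
      = ∑' i, a i * b i * ∑' w, f i w * h i w := by
  rw [(hF.mul hH).tsum_prod]
  refine tsum_congr fun i => ?_
  rw [← tsum_mul_left]
  exact tsum_congr fun w => by ring

lemma tsum_prod_sq_le (ha : SqSummable a) (ha1 : ∑' i, a i ^ 2 ≤ 1) (hf : ∀ i, SqSummable (f i))
    (hf1 : ∀ i, ∑' w, f i w ^ 2 ≤ 1) : ∑' z : α × β, (a z.1 * f z.1 z.2) ^ 2 ≤ 1 := by
  have h := ha.prod hf hf1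
  simp only [sq]
  rw [tsum_prod_mul h h]
  simp only [← sq]
  have hle : ∀ i, a i ^ 2 * ∑' w, f i w ^ 2 ≤ a i ^ 2 := fun i =>
    mul_le_of_le_one_right (sq_nonneg _) (hf1 i)
  have hs : Summable fun i => a i ^ 2 * ∑' w, f i w ^ 2 :=
    Summable.of_nonneg_of_le (fun i => mul_nonneg (sq_nonneg _) (tsum_nonneg fun w => sq_nonneg _))
      hle ha
  exact (hs.tsum_le_tsum hle ha).trans ha1

end prod

section

variable {q : ℝ} (hq₀ : 0 < q) (hq₁ : q < 1)
include hq₀ hq₁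

lemma sqSummable_row_nat (y p : ℤ) : SqSummable fun m : ℕ => cg q y (m - p) m :=
  (sqSummable_row_and_le hq₀ hq₁ y p).1.comp Nat.cast_injective

open Classical in
lemma tsum_cg_mul_cg_row_nat (x x' p : ℤ) :
    ∑' m : ℕ, cg q x (m - p) m * cg q x' (m - p) m = if x = x' ∧ 0 ≤ x then 1 else 0 := by
  rw [← tsum_cg_mul_cg_row hq₀ hq₁ x x' p, tsum_int_eq_tsum_nat]
  exact fun m hm => by simp [cg_of_neg_right q _ _ hm]

open Classical in
/-- The tree vectors are orthonormal. -/
lemma comb_orthonormal (N : ℕ) :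
    (∀ ρ y p, SqSummable (comb q ρ N y p)) ∧
    ∀ ρ ρ' y y' p p', ∑' v, comb q ρ N y p v * comb q ρ' N y' p' v =
      if y = y' ∧ 0 ≤ y ∧ (N ≠ 0 → p = p') ∧ ∀ i, 2 ≤ i → i ≤ N → ρ i = ρ' i then 1 else 0 := by
  induction N with
  | zero =>
    have e : ∀ (ρ : ℕ → ℤ) (y p : ℤ) (v : ℕ), comb q ρ 0 y p ((Equiv.funUnique (Fin 1) ℕ).symm v) =
        if (v : ℤ) = y then 1 else 0 := fun ρ y p v => rfl
    constructor
    · intro ρ y p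
      refine (Equiv.summable_iff (Equiv.funUnique (Fin 1) ℕ).symm).1 ?_
      refine summable_of_ne_finset_zero (s := {y.toNat}) fun v hv => ?_
      simp only [Function.comp_apply]
      rw [e, if_neg (by simp at hv; omega)]
      simp
    · intro ρ ρ' y y' p p'
      rw [← Equiv.tsum_eq (Equiv.funUnique (Fin 1) ℕ).symm]
      simp only [e]
      by_cases hy : y = y' ∧ 0 ≤ y
      · rw [if_pos ⟨hy.1, hy.2, fun h => absurd rfl h, fun i h1 h2 => by omega⟩]
        obtain ⟨rfl, hy⟩ := hy
        lift y to ℕ using hy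
        rw [tsum_eq_single y]
        · simp
        · intro v hv
          simp [hv]
      · rw [if_neg (by tauto)]
        refine (tsum_congr fun v => ?_).trans tsum_zero
        by_cases h1 : (v : ℤ) = y
        · rw [if_neg (c := (v : ℤ) = y') (by omega), mul_zero]
        · rw [if_neg h1, zero_mul]
  | succ N ih =>
    obtain ⟨ih1, ih2⟩ := ih
    have hle : ∀ ρ y p, ∑' v, comb q ρ N y p v ^ 2 ≤ 1 := by
      intro ρ y p
      simp only [sq]
      rw [ih2]
      split_ifs <;> norm_num
    have e : ∀ (ρ : ℕ → ℤ) (y p : ℤ) (z : ℕ × (Fin (N + 1) → ℕ)),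
        comb q ρ (N + 1) y p (Fin.snocEquiv (fun _ => ℕ) z) =
        cg q y (z.1 - p) z.1 * comb q ρ N (z.1 - p) (ρ (N + 1) - y + z.1) z.2 := by
      rintro ρ y p ⟨l, w⟩
      simp [comb, Fin.snocEquiv]
    have hs : ∀ ρ y p, SqSummable fun z : ℕ × (Fin (N + 1) → ℕ) =>
        cg q y (z.1 - p) z.1 * comb q ρ N (z.1 - p) (ρ (N + 1) - y + z.1) z.2 := fun ρ y p =>
      (sqSummable_row_nat hq₀ hq₁ y p).prod
        (f := fun l : ℕ => comb q ρ N (l - p) (ρ (N + 1) - y + l)) (fun l => ih1 _ _ _)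
        (fun l => hle _ _ _)
    refine ⟨fun ρ y p => ?_, fun ρ ρ' y y' p p' => ?_⟩
    · refine (Equiv.summable_iff (Fin.snocEquiv (fun _ => ℕ))).1 ?_
      exact (hs ρ y p).congr fun z => by rw [Function.comp_apply, e]
    · rw [← Equiv.tsum_eq (Fin.snocEquiv (fun _ => ℕ))]
      simp only [e]
      rw [tsum_prod_mul (a := fun l : ℕ => cg q y (l - p) l)
        (f := fun l : ℕ => comb q ρ N (l - p) (ρ (N + 1) - y + l))
        (b := fun l : ℕ => cg q y' (l - p') l)
        (h := fun l : ℕ => comb q ρ' N (l - p') (ρ' (N + 1) - y' + l)) (hs ρ y p) (hs ρ' y' p')]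
      simp only [ih2]
      by_cases hp : p = p'
      swap
      · rw [if_neg (fun h => hp (h.2.2.1 (Nat.succ_ne_zero N)))]
        refine (tsum_congr fun l => ?_).trans tsum_zero
        rw [if_neg (by rintro ⟨h, -⟩; omega), mul_zero]
      subst hp
      -- Both inner second parameters contain the same summand l, so whether the inner vectors match
      -- is independent of l. For N = 0 the second parameter is void.
      by_cases hP : (N ≠ 0 → ρ (N + 1) - y = ρ' (N + 1) - y') ∧ ∀ i, 2 ≤ i → i ≤ N → ρ i = ρ' i
      · rw [show (∑' l : ℕ, _) = _ from (tsum_congr fun l => ?_).trans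
          (tsum_cg_mul_cg_row_nat hq₀ hq₁ y y' p)]
        · congr 1
          rw [eq_iff_iff]
          refine ⟨fun ⟨h1, h2⟩ => ⟨h1, h2, fun _ => rfl, fun i hi hi' => ?_⟩, fun h => ⟨h.1, h.2.1⟩⟩
          rcases Nat.lt_or_ge N i with h | h
          · obtain rfl : i = N + 1 := by omega
            have := hP.1 (by omega)
            omega
          · exact hP.2 i hi h
        -- For l < p the inner vector is zero instead of a unit vector, but then the coefficient C
        -- vanishes as well.
        · by_cases hl : 0 ≤ (l : ℤ) - p
          · rw [if_pos ⟨rfl, hl, fun h => by have := hP.1 h; omega, hP.2⟩, mul_one]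
          · simp [cg_of_neg_mid q _ (not_le.1 hl)]
      · rw [if_neg]
        · refine (tsum_congr fun l => ?_).trans tsum_zero
          rw [if_neg, mul_zero]
          rintro ⟨-, -, h1, h2⟩
          exact hP ⟨fun h => by have := h1 h; omega, h2⟩
        · rintro ⟨rfl, -, -, h⟩
          exact hP ⟨fun h' => by rw [h (N + 1) (by omega) le_rfl], fun i h1 h2 => h i h1 (by omega)⟩

lemma sqSummable_comb (ρ : ℕ → ℤ) (N : ℕ) (y p : ℤ) : SqSummable (comb q ρ N y p) :=
  (comb_orthonormal hq₀ hq₁ N).1 ρ y p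

lemma tsum_comb_sq_le (ρ : ℕ → ℤ) (N : ℕ) (y p : ℤ) : ∑' v, comb q ρ N y p v ^ 2 ≤ 1 := by
  classical
  simp only [sq]
  rw [(comb_orthonormal hq₀ hq₁ N).2]
  split_ifs <;> norm_num

end

/-- The vectors `e_{y,p,σ,ρ} = ∑_m C_{y,m,m+p} e_m ⊗ E_k(m+p, y-m-σ)`. -/
def combR (q : ℝ) (ρ : ℕ → ℤ) (k : ℕ) (y p σ : ℤ) (v : Fin (k + 2) → ℕ) : ℝ :=
  cg q y (v 0) (v 0 + p) * comb q ρ k (v 0 + p) (y - v 0 - σ) (Fin.tail v)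

lemma sqSummable_combR_and_le {q : ℝ} (hq₀ : 0 < q) (hq₁ : q < 1) (ρ : ℕ → ℤ) (k : ℕ)
    (y p σ : ℤ) :
    SqSummable (combR q ρ k y p σ) ∧ ∑' v, combR q ρ k y p σ v ^ 2 ≤ 1 := by
  have h1 : SqSummable fun n : ℕ => cg q y n (n + p) := by
    have := sqSummable_row_nat hq₀ hq₁ y (-p)
    simpa only [sub_neg_eq_add, cg_symm q y (_ + p)] using this
  have h1' : ∑' n : ℕ, cg q y n (n + p) ^ 2 ≤ 1 := by
    classical
    have := tsum_cg_mul_cg_row_nat hq₀ hq₁ y y (-p)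
    simp only [sub_neg_eq_add, cg_symm q y (_ + p), ← sq] at this
    rw [this]
    split_ifs <;> norm_num
  have hs := fun n : ℕ => sqSummable_comb hq₀ hq₁ ρ k (n + p) (y - n - σ)
  have hl := fun n : ℕ => tsum_comb_sq_le hq₀ hq₁ ρ k (n + p) (y - n - σ)
  have e : ∀ z : ℕ × (Fin (k + 1) → ℕ), combR q ρ k y p σ (Fin.consEquiv (fun _ => ℕ) z) =
      cg q y z.1 (z.1 + p) * comb q ρ k (z.1 + p) (y - z.1 - σ) z.2 := fun z => by
    simp [combR, Fin.consEquiv]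
  constructor
  · refine (Equiv.summable_iff (Fin.consEquiv (fun _ => ℕ))).1 ?_
    exact (h1.prod hs hl).congr fun z => by rw [Function.comp_apply, e]
  · rw [← Equiv.tsum_eq (Fin.consEquiv (fun _ => ℕ))]
    simp only [e]
    exact tsum_prod_sq_le h1 h1' hs hl

/-- The constraint n - m + l = y - r is the delta function contributed by E_0. -/
lemma eLeft_eq_comb (q : ℝ) (y p r : ℤ) : eLeft q y p r = comb q (fun _ => r) 2 y p := by
  funext v
  simp only [eLeft, comb, Fin.init]
  have e0 : v (Fin.castSucc (Fin.castSucc 0)) = v 0 := rfl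
  have e1 : v (Fin.castSucc (Fin.last 1)) = v 1 := rfl
  have e2 : v (Fin.last 2) = v 2 := rfl
  simp only [Nat.reduceAdd, e0, e1, e2, mul_ite, mul_one, mul_zero]
  by_cases h : (v 0 : ℤ) - v 1 + v 2 = y - r
  · rw [if_pos h, if_pos (by omega), show (v 1 : ℤ) - (r - y + v 2) = v 0 by omega]
  · rw [if_neg h, if_neg (by omega)]

lemma eRight_eq_combR (q : ℝ) (ρ : ℕ → ℤ) (y p r : ℤ) : eRight q y p r = combR q ρ 1 y p r := by
  funext v
  simp only [eRight, comb, combR, Fin.init, Fin.tail]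
  have e1 : v (Fin.succ (Fin.castSucc 0)) = v 1 := rfl
  have e2 : v (Fin.succ (Fin.last 1)) = v 2 := rfl
  simp only [Nat.reduceAdd, e1, e2, mul_ite, mul_one, mul_zero]
  by_cases h : (v 0 : ℤ) - v 1 + v 2 = y - r
  · rw [if_pos h, if_pos (by omega), show (v 2 : ℤ) - (y - v 0 - r) = v 1 by omega]
  · rw [if_neg h, if_neg (by omega)]

/-! ### The `6j`-symbols as transition coefficients -/

/-- The coefficients of `e^{1(23)}_{y,p,r}`, extended to integer indices. -/
def rightZ (q : ℝ) (y p r : ℤ) (v : ℤ × ℤ × ℤ) : ℝ :=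
  if v.1 - v.2.1 + v.2.2 = y - r then cg q y v.1 (v.1 + p) * cg q (v.1 + p) v.2.1 v.2.2 else 0

/-- The coefficients of `e^{(12)3}_{y,p,r}`, extended to integer indices. -/
def leftZ (q : ℝ) (y p r : ℤ) (v : ℤ × ℤ × ℤ) : ℝ :=
  if v.1 - v.2.1 + v.2.2 = y - r then cg q y (v.2.2 - p) v.2.2 * cg q (v.2.2 - p) v.1 v.2.1 else 0

lemma rightZ_apply (q : ℝ) (y p r n m l : ℤ) : rightZ q y p r (n, m, l) =
    if n - m + l = y - r then cg q y n (n + p) * cg q (n + p) m l else 0 := rfl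

lemma leftZ_apply (q : ℝ) (y p r n m l : ℤ) : leftZ q y p r (n, m, l) =
    if n - m + l = y - r then cg q y (l - p) l * cg q (l - p) n m else 0 := rfl

/-- The inclusion of `ℕ³` in `ℤ³`. -/
def natIncl (v : Fin 3 → ℕ) : ℤ × ℤ × ℤ := (v 0, v 1, v 2)

lemma natIncl_injective : Function.Injective natIncl := by
  intro v w h
  simp only [natIncl, Prod.mk.injEq, Nat.cast_inj] at h
  funext i
  fin_cases i
  exacts [h.1, h.2.1, h.2.2]

lemma exists_neg_of_notMem_range {v : ℤ × ℤ × ℤ} (hv : v ∉ Set.range natIncl) :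
    v.1 < 0 ∨ v.2.1 < 0 ∨ v.2.2 < 0 := by
  by_contra! h
  refine hv ⟨![v.1.toNat, v.2.1.toNat, v.2.2.toNat], ?_⟩
  simp [natIncl, h.1, h.2.1, h.2.2]

lemma rightZ_eq_zero (q : ℝ) (y p r : ℤ) {v : ℤ × ℤ × ℤ} (hv : v ∉ Set.range natIncl) :
    rightZ q y p r v = 0 := by
  rcases exists_neg_of_notMem_range hv with h | h | h <;>
    simp [rightZ, cg_of_neg_mid q _ h, cg_of_neg_right q _ _ h]

lemma leftZ_eq_zero (q : ℝ) (y p r : ℤ) {v : ℤ × ℤ × ℤ} (hv : v ∉ Set.range natIncl) :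
    leftZ q y p r v = 0 := by
  rcases exists_neg_of_notMem_range hv with h | h | h <;>
    simp [leftZ, cg_of_neg_mid q _ h, cg_of_neg_right q _ _ h]

/-- The weights of `Δ²(γ)`. -/
def gammaW (q : ℝ) : Fin 4 → ℤ × ℤ × ℤ → ℝ :=
  ![fun v => gam q v.1 * (lad q (v.2.1 + 1) * lad q (v.2.2 + 1)),
    fun v => lad q v.1 * (gam q v.2.1 * lad q (v.2.2 + 1)),
    fun v => lad q v.1 * (lad q v.2.1 * gam q v.2.2),
    fun v => -(q * gam q v.1 * (gam q v.2.1 * gam q v.2.2))]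

/-- The translations of `Δ²(γ)`. -/
def gammaS : Fin 4 → ℤ × ℤ × ℤ := ![(0, 1, 1), (-1, 0, 1), (-1, -1, 0), (0, 0, 0)]

/-- The weights of `Δ²(α)`. -/
def alphaW (q : ℝ) : Fin 4 → ℤ × ℤ × ℤ → ℝ :=
  ![fun v => lad q (v.1 + 1) * (lad q (v.2.1 + 1) * lad q (v.2.2 + 1)),
    fun v => -(q * gam q v.1 * (gam q v.2.1 * lad q (v.2.2 + 1))),
    fun v => -(q * gam q v.1 * (lad q v.2.1 * gam q v.2.2)),
    fun v => -(q * lad q (v.1 + 1) * (gam q v.2.1 * gam q v.2.2))]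

/-- The translations of `Δ²(α)`. -/
def alphaS : Fin 4 → ℤ × ℤ × ℤ := ![(1, 1, 1), (0, 0, 1), (0, -1, 0), (1, 0, 0)]

/-! ### The iterated coproducts of γ and α on both bracketings, and the pairing between them. -/

section

variable {q : ℝ} (hq₀ : 0 < q) (hq₁ : q < 1)
include hq₀ hq₁

lemma sqSummable_eRight (y p r : ℤ) : SqSummable (eRight q y p r) := by
  rw [eRight_eq_combR q (fun _ => 0)]
  exact (sqSummable_combR_and_le hq₀ hq₁ _ _ _ _ _).1

lemma sqSummable_eLeft (y p r : ℤ) : SqSummable (eLeft q y p r) := by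
  rw [eLeft_eq_comb]
  exact sqSummable_comb hq₀ hq₁ _ _ _ _

lemma sqSummable_rightZ (y p r : ℤ) : SqSummable (rightZ q y p r) :=
  (Function.Injective.summable_iff natIncl_injective fun v hv => by
    rw [rightZ_eq_zero q y p r hv, sq, mul_zero]).1 (sqSummable_eRight hq₀ hq₁ y p r)

lemma sqSummable_leftZ (y p r : ℤ) : SqSummable (leftZ q y p r) :=
  (Function.Injective.summable_iff natIncl_injective fun v hv => by
    rw [leftZ_eq_zero q y p r hv, sq, mul_zero]).1 (sqSummable_eLeft hq₀ hq₁ y p r)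

lemma abs_gammaW_le (j : Fin 4) (v : ℤ × ℤ × ℤ) : |gammaW q j v| ≤ 1 := by
  have h1 := fun x => abs_lad_le (q := q) hq₀ x
  have h2 := abs_gam_le hq₀ hq₁
  have h3 : |q| ≤ 1 := by rw [abs_of_pos hq₀]; exact hq₁.le
  fin_cases j
  · exact abs_mul_le_one (h2 _) (abs_mul_le_one (h1 _) (h1 _))
  · exact abs_mul_le_one (h1 _) (abs_mul_le_one (h2 _) (h1 _))
  · exact abs_mul_le_one (h1 _) (abs_mul_le_one (h1 _) (h2 _))
  · exact (abs_neg _).trans_le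
      (abs_mul_le_one (abs_mul_le_one h3 (h2 _)) (abs_mul_le_one (h2 _) (h2 _)))

lemma abs_alphaW_le (j : Fin 4) (v : ℤ × ℤ × ℤ) : |alphaW q j v| ≤ 1 := by
  have h1 := fun x => abs_lad_le (q := q) hq₀ x
  have h2 := abs_gam_le hq₀ hq₁
  have h3 : |q| ≤ 1 := by rw [abs_of_pos hq₀]; exact hq₁.le
  fin_cases j
  · exact abs_mul_le_one (h1 _) (abs_mul_le_one (h1 _) (h1 _))
  · exact (abs_neg _).trans_le
      (abs_mul_le_one (abs_mul_le_one h3 (h2 _)) (abs_mul_le_one (h2 _) (h1 _)))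
  · exact (abs_neg _).trans_le
      (abs_mul_le_one (abs_mul_le_one h3 (h2 _)) (abs_mul_le_one (h1 _) (h2 _)))
  · exact (abs_neg _).trans_le
      (abs_mul_le_one (abs_mul_le_one h3 (h1 _)) (abs_mul_le_one (h2 _) (h2 _)))

/-- Here Δ²(γ) is grouped as γ⊗Δ(α) + α*⊗Δ(γ), acting first on the inner pair and then at the root.
For `leftZ` the same operator is grouped as Δ(γ)⊗α + Δ(α*)⊗γ. -/
lemma gamma_rightZ (y p r : ℤ) (v : ℤ × ℤ × ℤ) :
    ∑ j, gammaW q j v * rightZ q y p r (v + gammaS j) = gam q y * rightZ q y (p - 1) r v := by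
  obtain ⟨n, m, l⟩ := v
  simp only [Fin.sum_univ_four, gammaW, gammaS, Matrix.cons_val, Prod.mk_add_mk, rightZ_apply]
  by_cases h : n - m + l = y - r
  swap
  · rw [if_neg h, if_neg (by omega), if_neg (by omega), if_neg (by omega), if_neg (by omega)]
    ring
  rw [if_pos h, if_pos (by omega), if_pos (by omega), if_pos (by omega), if_pos (by omega)]
  simp only [add_zero, ← sub_eq_add_neg]
  have h1 := cg_alpha hq₀ hq₁ (n + p) m l
  have h2 := cg_gamma hq₀ hq₁ (n - 1 + p) m l
  have h3 := cg_gamma hq₀ hq₁ y n (n + p - 1)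
  rw [show n + p - 1 + 1 = n + p by ring] at h3
  rw [show n - 1 + p = n + p - 1 by ring, show n + (p - 1) = n + p - 1 by ring] at *
  linear_combination gam q n * cg q y n (n + p) * h1
    + lad q n * cg q y (n - 1) (n + p - 1) * h2 + cg q (n + p - 1) m l * h3

lemma gamma_leftZ (y p r : ℤ) (v : ℤ × ℤ × ℤ) :
    ∑ j, gammaW q j v * leftZ q y p r (v + gammaS j) = gam q y * leftZ q y (p - 1) r v := by
  obtain ⟨n, m, l⟩ := v
  simp only [Fin.sum_univ_four, gammaW, gammaS, Matrix.cons_val, Prod.mk_add_mk, leftZ_apply]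
  by_cases h : n - m + l = y - r
  swap
  · rw [if_neg h, if_neg (by omega), if_neg (by omega), if_neg (by omega), if_neg (by omega)]
    ring
  rw [if_pos h, if_pos (by omega), if_pos (by omega), if_pos (by omega), if_pos (by omega)]
  simp only [add_zero, ← sub_eq_add_neg]
  have h1 := cg_gamma hq₀ hq₁ (l + 1 - p) n m
  have h2 := cg_alpha_star hq₀ hq₁ (l - p) n m
  have h3 := cg_gamma hq₀ hq₁ y (l + 1 - p) l
  rw [show l + 1 - p - 1 = l - p by ring] at h3
  rw [show l - p + 1 = l + 1 - p by ring] at h2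
  rw [show l - (p - 1) = l + 1 - p by ring]
  linear_combination lad q (l + 1) * cg q y (l + 1 - p) (l + 1) * h1
    + gam q l * cg q y (l - p) l * h2 + cg q (l + 1 - p) n m * h3

lemma gamma_adj_leftZ (y p r : ℤ) (v : ℤ × ℤ × ℤ) :
    ∑ j, gammaW q j (v - gammaS j) * leftZ q y p r (v - gammaS j)
      = gam q y * leftZ q y (p + 1) r v := by
  obtain ⟨n, m, l⟩ := v
  simp only [Fin.sum_univ_four, gammaW, gammaS, Matrix.cons_val, Prod.mk_sub_mk, leftZ_apply]
  by_cases h : n - m + l = y - r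
  swap
  · rw [if_neg h, if_neg (by omega), if_neg (by omega), if_neg (by omega), if_neg (by omega)]
    ring
  rw [if_pos h, if_pos (by omega), if_pos (by omega), if_pos (by omega), if_pos (by omega)]
  simp only [sub_zero, sub_neg_eq_add, sub_add_cancel]
  have h1 := cg_alpha hq₀ hq₁ (l - p) n m
  have h2 := cg_gamma_star hq₀ hq₁ (l - 1 - p) n m
  have h3 := cg_gamma_star hq₀ hq₁ y (l - 1 - p) l
  rw [show l - 1 - p + 1 = l - p by ring] at h3
  rw [show l - p - 1 = l - 1 - p by ring] at h1
  rw [show l - (p + 1) = l - 1 - p by ring]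
  linear_combination gam q l * cg q y (l - p) l * h1
    + lad q l * cg q y (l - 1 - p) (l - 1) * h2 + cg q (l - 1 - p) n m * h3

lemma gamma_adj_rightZ (y p r : ℤ) (v : ℤ × ℤ × ℤ) :
    ∑ j, gammaW q j (v - gammaS j) * rightZ q y p r (v - gammaS j)
      = gam q y * rightZ q y (p + 1) r v := by
  obtain ⟨n, m, l⟩ := v
  simp only [Fin.sum_univ_four, gammaW, gammaS, Matrix.cons_val, Prod.mk_sub_mk, rightZ_apply]
  by_cases h : n - m + l = y - r
  swap
  · rw [if_neg h, if_neg (by omega), if_neg (by omega), if_neg (by omega), if_neg (by omega)]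
    ring
  rw [if_pos h, if_pos (by omega), if_pos (by omega), if_pos (by omega), if_pos (by omega)]
  simp only [sub_zero, sub_neg_eq_add, sub_add_cancel]
  have h1 := cg_alpha_star hq₀ hq₁ (n + p) m l
  have h2 := cg_gamma_star hq₀ hq₁ (n + 1 + p) m l
  have h3 := cg_gamma_star hq₀ hq₁ y n (n + 1 + p)
  rw [show n + 1 + p - 1 = n + p by ring] at h3
  rw [show n + p + 1 = n + 1 + p by ring] at h1
  rw [show n + (p + 1) = n + 1 + p by ring]
  linear_combination gam q n * cg q y n (n + p) * h1
    + lad q (n + 1) * cg q y (n + 1) (n + 1 + p) * h2 + cg q (n + 1 + p) m l * h3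

/-- The grouping is α⊗Δ(α) - qγ⊗Δ(γ); in `alpha_adj_leftZ` the adjoint is grouped as Δ(α*)⊗α* -
qΔ(γ)⊗γ. -/
lemma alpha_rightZ (y p r : ℤ) (v : ℤ × ℤ × ℤ) :
    ∑ j, alphaW q j v * rightZ q y p r (v + alphaS j) = lad q y * rightZ q (y - 1) p r v := by
  obtain ⟨n, m, l⟩ := v
  simp only [Fin.sum_univ_four, alphaW, alphaS, Matrix.cons_val, Prod.mk_add_mk, rightZ_apply]
  by_cases h : n - m + l = y - 1 - r
  swap
  · rw [if_neg h, if_neg (by omega), if_neg (by omega), if_neg (by omega), if_neg (by omega)]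
    ring
  rw [if_pos h, if_pos (by omega), if_pos (by omega), if_pos (by omega), if_pos (by omega)]
  simp only [add_zero, ← sub_eq_add_neg]
  have h1 := cg_alpha hq₀ hq₁ (n + 1 + p) m l
  have h2 := cg_gamma hq₀ hq₁ (n + p) m l
  have h3 := cg_alpha hq₀ hq₁ y n (n + p)
  rw [show n + p + 1 = n + 1 + p by ring] at h3
  rw [show n + 1 + p - 1 = n + p by ring] at h1
  linear_combination lad q (n + 1) * cg q y (n + 1) (n + 1 + p) * h1
    - q * gam q n * cg q y n (n + p) * h2 + cg q (n + p) m l * h3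

lemma alpha_adj_leftZ (y p r : ℤ) (v : ℤ × ℤ × ℤ) :
    ∑ j, alphaW q j (v - alphaS j) * leftZ q (y - 1) p r (v - alphaS j)
      = lad q y * leftZ q y p r v := by
  obtain ⟨n, m, l⟩ := v
  simp only [Fin.sum_univ_four, alphaW, alphaS, Matrix.cons_val, Prod.mk_sub_mk, leftZ_apply]
  by_cases h : n - m + l = y - r
  swap
  · rw [if_neg h, if_neg (by omega), if_neg (by omega), if_neg (by omega), if_neg (by omega)]
    ring
  rw [if_pos h, if_pos (by omega), if_pos (by omega), if_pos (by omega), if_pos (by omega)]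
  simp only [sub_zero, sub_neg_eq_add, sub_add_cancel]
  have h1 := cg_alpha_star hq₀ hq₁ (l - 1 - p) n m
  have h2 := cg_gamma hq₀ hq₁ (l - p) n m
  have h3 := cg_alpha_star hq₀ hq₁ (y - 1) (l - p) l
  rw [show l - p - 1 = l - 1 - p by ring, sub_add_cancel] at h3
  rw [show l - 1 - p + 1 = l - p by ring] at h1
  linear_combination lad q l * cg q (y - 1) (l - 1 - p) (l - 1) * h1
    - q * gam q l * cg q (y - 1) (l - p) l * h2 + cg q (l - p) n m * h3

/-- The inner product of `e^{(12)3}_{y',p₂,r'}` and `e^{1(23)}_{y,p₁,r}`. -/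
def pairing (q : ℝ) (y p₁ r y' p₂ r' : ℤ) : ℝ := ∑' v, eLeft q y' p₂ r' v * eRight q y p₁ r v

omit hq₀ hq₁ in
lemma pairing_eq (y p₁ r y' p₂ r' : ℤ) :
    pairing q y p₁ r y' p₂ r' = ∑' v, rightZ q y p₁ r v * leftZ q y' p₂ r' v := by
  rw [← Function.Injective.tsum_eq natIncl_injective]
  · exact tsum_congr fun v => mul_comm _ _
  · intro v hv
    by_contra h
    exact hv (by simp [rightZ_eq_zero q _ _ _ h])

lemma gam_mul_pairing_pred_left (y p₁ r y' p₂ r' : ℤ) :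
    gam q y * pairing q y (p₁ - 1) r y' p₂ r' = gam q y' * pairing q y p₁ r y' (p₂ + 1) r' := by
  have key := tsum_shift_adjoint (abs_gammaW_le hq₀ hq₁) gammaS
    (sqSummable_rightZ hq₀ hq₁ y p₁ r) (sqSummable_leftZ hq₀ hq₁ y' p₂ r')
  simp only [gamma_rightZ hq₀ hq₁, gamma_adj_leftZ hq₀ hq₁] at key
  rw [pairing_eq, pairing_eq, ← tsum_mul_left, ← tsum_mul_left]
  refine Eq.trans (tsum_congr fun m => ?_) (key.trans (tsum_congr fun m => ?_)) <;> ring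

lemma gam_mul_pairing_pred_right (y p₁ r y' p₂ r' : ℤ) :
    gam q y' * pairing q y p₁ r y' (p₂ - 1) r' = gam q y * pairing q y (p₁ + 1) r y' p₂ r' := by
  have key := tsum_shift_adjoint (abs_gammaW_le hq₀ hq₁) gammaS
    (sqSummable_leftZ hq₀ hq₁ y' p₂ r') (sqSummable_rightZ hq₀ hq₁ y p₁ r)
  simp only [gamma_leftZ hq₀ hq₁, gamma_adj_rightZ hq₀ hq₁] at key
  rw [pairing_eq, pairing_eq, ← tsum_mul_left, ← tsum_mul_left]
  refine Eq.trans (tsum_congr fun m => ?_) (key.trans (tsum_congr fun m => ?_)) <;> ring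

/-- Different levels are separated by the eigenvalues q^{2y}; at equal level, different r give
disjoint supports. -/
lemma pairing_eq_zero {y y' : ℤ} (hy : 0 ≤ y) (hy' : 0 ≤ y') {r r' : ℤ} (h : y ≠ y' ∨ r ≠ r')
    (p₁ p₂ : ℤ) : pairing q y p₁ r y' p₂ r' = 0 := by
  by_cases hyy : y = y'
  · have hr := h.resolve_left (not_not.2 hyy)
    refine (tsum_congr fun v => ?_).trans tsum_zero
    rw [eLeft, eRight]
    split_ifs with h1 h2
    · omega
    · exact mul_zero _
    · exact zero_mul _
    · exact zero_mul _
  · have h1 := gam_mul_pairing_pred_left hq₀ hq₁ y p₁ r y' (p₂ - 1) r'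
    have h2 := gam_mul_pairing_pred_right hq₀ hq₁ y (p₁ - 1) r y' p₂ r'
    rw [sub_add_cancel] at h1 h2
    have h3 : (gam q y ^ 2 - gam q y' ^ 2) * pairing q y p₁ r y' p₂ r' = 0 := by
      linear_combination gam q y' * h1 - gam q y * h2
    exact (mul_eq_zero.1 h3).resolve_left fun h4 =>
      hyy (gam_sq_injOn hq₀ hq₁ hy hy' (sub_eq_zero.1 h4))

lemma pairing_add_nat (y p₁ r p₂ : ℤ) (c : ℕ) :
    pairing q y (p₁ + c) r y (p₂ + c) r = pairing q y p₁ r y p₂ r := by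
  induction c with
  | zero => simp
  | succ c ih =>
    have := gam_mul_pairing_pred_left hq₀ hq₁ y (p₁ + c + 1) r y (p₂ + c) r
    rw [add_sub_cancel_right] at this
    rw [← ih, mul_left_cancel₀ (gam_pos hq₀ y).ne' this]
    push_cast
    simp only [add_assoc]

lemma pairing_add (y p₁ r p₂ c : ℤ) :
    pairing q y (p₁ + c) r y (p₂ + c) r = pairing q y p₁ r y p₂ r := by
  rcases le_total 0 c with h | h
  · lift c to ℕ using h
    exact pairing_add_nat hq₀ hq₁ y p₁ r p₂ c
  · have := pairing_add_nat hq₀ hq₁ y (p₁ + c) r (p₂ + c) (-c).toNat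
    rw [Int.toNat_of_nonneg (by omega), add_neg_cancel_right, add_neg_cancel_right] at this
    exact this.symm

/-- Δ²(α) lowers y by one on both bracketings with the same nonzero factor `lad`. -/
lemma pairing_eq_pairing_zero (y : ℕ) (p₁ r p₂ : ℤ) :
    pairing q y p₁ r y p₂ r = pairing q 0 p₁ r 0 p₂ r := by
  induction y with
  | zero => simp
  | succ y ih =>
    rw [← ih]
    have key := tsum_shift_adjoint (abs_alphaW_le hq₀ hq₁) alphaS
      (sqSummable_rightZ hq₀ hq₁ (y + 1 : ℕ) p₁ r)
      (sqSummable_leftZ hq₀ hq₁ ((y + 1 : ℕ) - 1) p₂ r)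
    simp only [alpha_rightZ hq₀ hq₁, alpha_adj_leftZ hq₀ hq₁] at key
    rw [pairing_eq, pairing_eq]
    refine mul_left_cancel₀ (lad_ne_zero hq₀ hq₁ (show (0 : ℤ) < (y + 1 : ℕ) by omega)) ?_
    rw [← tsum_mul_left, ← tsum_mul_left]
    refine Eq.trans (tsum_congr fun m => ?_) (key.symm.trans (tsum_congr fun m => ?_))
    · ring
    · push_cast
      rw [add_sub_cancel_right]
      ring

end

/-! ### Completeness of the vectors e^{(12)3} and recoupling of three factors. -/

section

variable {q : ℝ} (hq₀ : 0 < q) (hq₁ : q < 1)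
include hq₀ hq₁

lemma eLeft_orthonormal (k k' : ℤ × ℕ × ℤ) :
    ∑' v, eLeft q k.2.1 k.1 k.2.2 v * eLeft q k'.2.1 k'.1 k'.2.2 v = if k = k' then 1 else 0 := by
  simp only [eLeft_eq_comb]
  rw [(comb_orthonormal hq₀ hq₁ 2).2]
  congr 1
  rw [eq_iff_iff, Prod.ext_iff, Prod.ext_iff]
  constructor
  · rintro ⟨h1, -, h2, h3⟩
    exact ⟨h2 two_ne_zero, by exact_mod_cast h1, h3 2 le_rfl le_rfl⟩
  · rintro ⟨h1, h2, h3⟩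
    exact ⟨by rw [h2], by positivity, fun _ => h1, fun _ _ _ => h3⟩

/-- For fixed p and y a single r contributes. Column orthogonality removes the root coefficient in
the sum over y, and then the inner coefficient in the sum over p. -/
lemma tsum_eLeft_sq (v : Fin 3 → ℕ) :
    ∑' k : ℤ × ℕ × ℤ, eLeft q k.2.1 k.1 k.2.2 v ^ 2 = 1 := by
  have hS : Summable fun k : ℤ × ℕ × ℤ => eLeft q k.2.1 k.1 k.2.2 v ^ 2 :=
    (bessel_coord (fun k : ℤ × ℕ × ℤ => sqSummable_eLeft hq₀ hq₁ k.2.1 k.1 k.2.2)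
      (eLeft_orthonormal hq₀ hq₁) v).1
  rw [hS.tsum_prod]
  have hp : ∀ p : ℤ, ∑' c : ℕ × ℤ, eLeft q c.1 p c.2 v ^ 2 = cg q (v 2 - p) (v 0) (v 1) ^ 2 := by
    intro p
    rw [(hS.prod_factor p).tsum_prod]
    have hr : ∀ y : ℕ, ∑' r : ℤ, eLeft q y p r v ^ 2 =
        cg q y (v 2 - p) (v 2) * cg q y (v 2 - p) (v 2) * cg q (v 2 - p) (v 0) (v 1) ^ 2 := by
      intro y
      rw [tsum_eq_single ((y : ℤ) - ((v 0 : ℤ) - v 1 + v 2))]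
      · rw [eLeft, if_pos (by ring)]
        ring
      · intro r hr
        rw [eLeft, if_neg (by omega)]
        simp
    simp only [hr]
    rw [tsum_mul_right]
    by_cases h : 0 ≤ (v 2 : ℤ) - p
    · have := tsum_cg_mul_cg_col hq₀ hq₁ p (v 2) (v 2)
      rw [if_pos ⟨rfl, by positivity, h⟩,
        tsum_int_eq_tsum_nat fun x hx => by simp [cg_of_neg_left q hx]] at this
      rw [this, one_mul]
    · simp [cg_of_neg_left q (not_le.1 h)]
  simp only [hp]
  rw [← (Equiv.subLeft (v 2 : ℤ)).tsum_eq]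
  simp only [Equiv.subLeft_apply, sub_sub_cancel]
  have := tsum_cg_mul_cg_col hq₀ hq₁ ((v 1 : ℤ) - v 0) (v 1) (v 1)
  rw [if_pos ⟨rfl, by positivity, by omega⟩] at this
  simpa [sq] using this

/-- The expansion of `e^{1(23)}` in the vectors `e^{(12)3}`. -/
lemma eRight_hasSum (y : ℕ) (p r : ℤ) (v : Fin 3 → ℕ) :
    HasSum (fun p₂ : ℤ => pairing q 0 p r 0 p₂ r * eLeft q y p₂ r v) (eRight q y p r v) := by
  have h := hasSum_of_parseval (fun k : ℤ × ℕ × ℤ => sqSummable_eLeft hq₀ hq₁ k.2.1 k.1 k.2.2)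
      (eLeft_orthonormal hq₀ hq₁) (tsum_eLeft_sq hq₀ hq₁ v) (sqSummable_eRight hq₀ hq₁ y p r)
  -- Only the indices with the same y and r survive, by `pairing_eq_zero`.
  have hi : Function.Injective fun p₂ : ℤ => ((p₂, y, r) : ℤ × ℕ × ℤ) := fun a b hab =>
    (Prod.ext_iff.1 hab).1
  rw [← hi.hasSum_iff] at h
  · refine h.congr_fun fun p₂ => ?_
    simp only [Function.comp_apply]
    rw [← pairing_eq_pairing_zero hq₀ hq₁ y p r p₂, pairing]
  · rintro ⟨p₂, y', r'⟩ hk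
    have := pairing_eq_zero hq₀ hq₁ (y := y) (y' := y') (r := r) (r' := r') (by positivity)
      (by positivity) (by
        by_contra! h'
        obtain ⟨h1, h2⟩ := h'
        exact hk ⟨p₂, by simp [h2]; exact_mod_cast h1⟩) p p₂
    rw [pairing] at this
    simp only
    rw [this, zero_mul]

/-- Bessel's inequality for a vector of norm at most 1. -/
lemma tsum_pairing_sq_le (p r : ℤ) :
    SqSummable (fun p₂ => pairing q 0 p r 0 p₂ r) ∧ ∑' p₂, pairing q 0 p r 0 p₂ r ^ 2 ≤ 1 := by
  have h := bessel (fun p₂ : ℤ => sqSummable_eLeft hq₀ hq₁ 0 p₂ r)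
    (fun k k' => by
      have := eLeft_orthonormal hq₀ hq₁ (k, 0, r) (k', 0, r)
      simpa using this) (sqSummable_eRight hq₀ hq₁ 0 p r)
  refine ⟨h.1, h.2.trans ?_⟩
  rw [eRight_eq_combR q (fun _ => 0)]
  exact (sqSummable_combR_and_le hq₀ hq₁ _ _ _ _ _).2

/-- The recoupling of three tensor factors, on coefficients. -/
lemma cg_mul_cg_hasSum {y : ℤ} (hy : 0 ≤ y) (p σ c : ℤ) (n l : ℕ) :
    HasSum (fun p₂ : ℤ => pairing q 0 p σ 0 p₂ σ *
        (cg q y (l - p₂ - c) l * cg q (l - p₂ - c) n (n + (l - y + σ))))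
      (cg q y n (n + (p + c)) * cg q (n + (p + c)) (n + (l - y + σ)) l) := by
  by_cases hM : (n : ℤ) + (l - y + σ) < 0
  · simp [cg_of_neg_mid q _ hM, cg_of_neg_right q _ _ hM]
  lift y to ℕ using hy
  obtain ⟨M, hM⟩ : ∃ M : ℕ, (M : ℤ) = n + (l - y + σ) := ⟨_, Int.toNat_of_nonneg (by omega)⟩
  rw [← hM]
  have h := eRight_hasSum hq₀ hq₁ y (p + c) σ ![n, M, l]
  -- After replacing p₂ by p₂ + c, `pairing_add` removes c from the 6j-symbol.
  rw [← (Equiv.addRight c).hasSum_iff] at h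
  have hc : (n : ℤ) - M + l = y - σ := by omega
  have e1 : eRight q y (p + c) σ ![n, M, l] = cg q y n (n + (p + c)) * cg q (n + (p + c)) M l := by
    rw [eRight, if_pos (by simpa using hc)]
    simp
  rw [e1] at h
  refine h.congr_fun fun p₂ => ?_
  simp only [Function.comp_apply, Equiv.coe_addRight]
  rw [pairing_add hq₀ hq₁, eLeft, if_pos (by simpa using hc)]
  simp [sub_sub]

omit hq₀ hq₁ in
lemma comb_congr {ρ ρ' : ℕ → ℤ} (N : ℕ) (h : ∀ i ≤ N, ρ i = ρ' i) (y p : ℤ) :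
    comb q ρ N y p = comb q ρ' N y p := by
  induction N generalizing y p with
  | zero => rfl
  | succ N ih =>
    funext v
    simp only [comb]
    rw [ih fun i hi => h i (by omega), h (N + 1) le_rfl]

/-- Moving the root of the right subtree to the left. -/
lemma combR_succ_hasSum (ρ : ℕ → ℤ) (k : ℕ) {y : ℤ} (hy : 0 ≤ y) (p σ c : ℤ)
    (v : Fin (k + 3) → ℕ) :
    HasSum (fun p₂ : ℤ => pairing q 0 p σ 0 p₂ σ *
        (cg q y (v (Fin.last (k + 2)) - p₂ - c) (v (Fin.last (k + 2))) *
          combR q ρ k (v (Fin.last (k + 2)) - p₂ - c) (v (Fin.last (k + 2)) - y + σ)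
            (p - p₂ - ρ (k + 1)) (Fin.init v)))
      (combR q ρ (k + 1) y (p + c) σ v) := by
  -- The middle subtree acts as one tensor factor: its level v 0 + (l - y + σ) is forced, so its
  -- coefficient is common to all terms.
  have h := (cg_mul_cg_hasSum hq₀ hq₁ hy p σ c (v 0) (v (Fin.last (k + 2)))).mul_right
    (comb q ρ k (v 0 + (v (Fin.last (k + 2)) - y + σ))
      (ρ (k + 1) - (v 0 + (p + c)) + v (Fin.last (k + 2))) (Fin.init (Fin.tail v)))
  have e : combR q ρ (k + 1) y (p + c) σ v = cg q y (v 0) (v 0 + (p + c)) *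
      cg q (v 0 + (p + c)) (v 0 + (v (Fin.last (k + 2)) - y + σ)) (v (Fin.last (k + 2))) *
      comb q ρ k (v 0 + (v (Fin.last (k + 2)) - y + σ))
      (ρ (k + 1) - (v 0 + (p + c)) + v (Fin.last (k + 2))) (Fin.init (Fin.tail v)) := by
    have e1 : Fin.tail v (Fin.last (k + 1)) = v (Fin.last (k + 2)) := rfl
    rw [combR, comb, e1, show (v (Fin.last (k + 2)) : ℤ) - (y - v 0 - σ) =
      v 0 + (v (Fin.last (k + 2)) - y + σ) by ring]
    ring
  rw [e]
  refine h.congr_fun fun p₂ => ?_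
  have e2 : Fin.init v 0 = v 0 := rfl
  rw [combR, e2, Fin.tail_init_eq_init_tail,
    show (v (Fin.last (k + 2)) : ℤ) - p₂ - c - v 0 - (p - p₂ - ρ (k + 1)) =
      ρ (k + 1) - (v 0 + (p + c)) + v (Fin.last (k + 2)) by ring]
  ring

end

/-! ### Coupling coefficients -/

/-- The real number underlying `racah`. -/
def racahReal (q : ℝ) (x n₁ n₂ n₃ a b : ℤ) : ℝ :=
  pairing q 0 (a - n₁) (x - n₁ + n₂ - n₃) 0 (n₃ - b) (x - n₁ + n₂ - n₃)

/-- The product of `6j`-symbols, as a real number. -/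
def couplingProd (q : ℝ) (k : ℕ) (x : ℤ) (n r : ℕ → ℤ) (s : Fin k → ℤ) : ℝ :=
  ∏ j ∈ Finset.Icc 1 k, racahReal q (seq (n 1) s x (j + 1)) (n 1) (r (j - 1)) (n (j + 2)) (r j)
    (seq (n 1) s x j)

/-- The coefficients of the vectors of the left-branched trees, with the second parameter shifted
by `c`. -/
def treeComb (q : ℝ) (k : ℕ) (x y c : ℤ) (n : ℕ → ℤ) (s : Fin k → ℤ) : (Fin (k + 2) → ℕ) → ℝ :=
  comb q (multLabel (seq (n 1) s x) n) (k + 1) y (n (k + 2) - seq (n 1) s x k + c)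

lemma seq_succ_of_lt {k : ℕ} (a : ℤ) (s : Fin k → ℤ) (b : ℤ) {j : ℕ} (h : j < k) :
    seq a s b (j + 1) = s ⟨j, h⟩ := dif_pos h

lemma seq_succ_of_le {k : ℕ} (a : ℤ) (s : Fin k → ℤ) (b : ℤ) {j : ℕ} (h : k ≤ j) :
    seq a s b (j + 1) = b := dif_neg (by omega)

lemma seq_snoc {k : ℕ} (a : ℤ) (s : Fin k → ℤ) (b x : ℤ) {j : ℕ} (h : j ≤ k + 1) :
    seq a (Fin.snoc s b : Fin (k + 1) → ℤ) x j = seq a s b j := by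
  rcases j with _ | j
  · rfl
  rw [seq_succ_of_lt _ _ _ (show j < k + 1 by omega)]
  rcases Nat.lt_or_ge j k with hj | hj
  · rw [seq_succ_of_lt _ _ _ hj]
    exact Fin.snoc_castSucc (α := fun _ => ℤ) b s ⟨j, hj⟩
  · obtain rfl : j = k := by omega
    rw [seq_succ_of_le _ _ _ le_rfl]
    exact Fin.snoc_last (α := fun _ => ℤ) b s

/-- The last internal label b becomes the root label of the shorter tree. -/
lemma couplingProd_snoc (q : ℝ) (k : ℕ) (x : ℤ) (n r : ℕ → ℤ) (b : ℤ) (s : Fin k → ℤ) :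
    couplingProd q (k + 1) x n r (Fin.snoc s b : Fin (k + 1) → ℤ) =
      racahReal q x (n 1) (r k) (n (k + 3)) (r (k + 1)) b * couplingProd q k b n r s := by
  rw [couplingProd, Finset.prod_Icc_succ_top (by omega), mul_comm]
  congr 1
  · rw [seq_succ_of_le _ _ _ le_rfl, seq_snoc _ _ _ _ le_rfl, seq_succ_of_le _ _ _ le_rfl]
    rfl
  · refine Finset.prod_congr rfl fun j hj => ?_
    have := (Finset.mem_Icc.1 hj).2
    rw [seq_snoc _ _ _ _ (by omega), seq_snoc _ _ _ _ (by omega)]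

section

variable {q : ℝ} (hq₀ : 0 < q) (hq₁ : q < 1)
include hq₀ hq₁

/-- Bessel is iterated: for fixed b the remaining product has norm at most 1, and the outer factor
is a row of 6j-symbols in b. -/
lemma sqSummable_couplingProd_and_le (k : ℕ) (x : ℤ) (n r : ℕ → ℤ) :
    SqSummable (couplingProd q k x n r) ∧ ∑' s, couplingProd q k x n r s ^ 2 ≤ 1 := by
  induction k generalizing x with
  | zero =>
    constructor
    · exact Summable.of_finite
    · rw [tsum_fintype]
      simp [couplingProd]
  | succ k ih =>
    have e : ∀ z : ℤ × (Fin k → ℤ), couplingProd q (k + 1) x n r (Fin.snocEquiv (fun _ => ℤ) z) =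
        racahReal q x (n 1) (r k) (n (k + 3)) (r (k + 1)) z.1 * couplingProd q k z.1 n r z.2 :=
      fun z => couplingProd_snoc q k x n r z.1 z.2
    obtain ⟨h1, h2⟩ := tsum_pairing_sq_le hq₀ hq₁ (r (k + 1) - n 1) (x - n 1 + r k - n (k + 3))
    have h1' : SqSummable (racahReal q x (n 1) (r k) (n (k + 3)) (r (k + 1))) :=
      h1.comp (Equiv.subLeft (n (k + 3))).injective
    have h2' : ∑' b, racahReal q x (n 1) (r k) (n (k + 3)) (r (k + 1)) b ^ 2 ≤ 1 := by
      rw [← (Equiv.subLeft (n (k + 3))).tsum_eq] at h2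
      exact h2
    constructor
    · refine (Equiv.summable_iff (Fin.snocEquiv (fun _ => ℤ))).1 ?_
      exact (h1'.prod (fun b => (ih b).1) fun b => (ih b).2).congr fun z => by
        rw [Function.comp_apply, e]
    · rw [← Equiv.tsum_eq (Fin.snocEquiv (fun _ => ℤ))]
      simp only [e]
      exact tsum_prod_sq_le h1' h2' (fun b => (ih b).1) fun b => (ih b).2

lemma sqSummable_treeComb (k : ℕ) (x y c : ℤ) (n : ℕ → ℤ) (s : Fin k → ℤ) :
    SqSummable (treeComb q k x y c n s) := sqSummable_comb hq₀ hq₁ _ _ _ _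

/-- The parameters determine the labels: p yields s_k, and ρ_i yields s_{i-2} from s_i, descending
from s_{k+1} = x. -/
lemma treeComb_orthonormal (k : ℕ) (x c : ℤ) {y : ℤ} (hy : 0 ≤ y) (n : ℕ → ℤ) (s s' : Fin k → ℤ) :
    ∑' v, treeComb q k x y c n s v * treeComb q k x y c n s' v = if s = s' then 1 else 0 := by
  classical
  simp only [treeComb]
  rw [(comb_orthonormal hq₀ hq₁ (k + 1)).2]
  congr 1
  rw [eq_iff_iff]
  refine ⟨fun ⟨_, _, h1, h2⟩ => ?_, fun h => by subst h; exact ⟨rfl, hy, fun _ => rfl, fun _ _ _ => rfl⟩⟩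
  have key : ∀ j ≤ k + 1, seq (n 1) s x (k + 1 - j) = seq (n 1) s' x (k + 1 - j) := by
    intro j
    induction j using Nat.strong_induction_on with
    | _ j ih =>
      intro hj
      rcases j with _ | _ | j
      · simp [seq_succ_of_le]
      · have := h1 (Nat.succ_ne_zero k)
        simp only [zero_add, add_tsub_cancel_right]
        omega
      · have := h2 (k + 1 - j) (by omega) (by omega)
        rw [multLabel, multLabel, ih j (by omega) (by omega),
          show k + 1 - j - 2 = k + 1 - (j + 1 + 1) by omega] at this
        omega
  funext i
  have := key (k - i) (by omega)
  rw [show k + 1 - (k - (i : ℕ)) = i + 1 by omega, seq_succ_of_lt _ _ _ i.2,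
    seq_succ_of_lt _ _ _ i.2] at this
  exact this

-- The left subtree occurs at a level other than its root label b. The discrepancy enters its second
-- parameter, which is why the induction carries independent x, y and c.
omit hq₀ hq₁ in
lemma treeComb_snoc (k : ℕ) (x y c b : ℤ) (n : ℕ → ℤ) (s : Fin k → ℤ) (v : Fin (k + 3) → ℕ) :
    treeComb q (k + 1) x y c n (Fin.snoc s b : Fin (k + 1) → ℤ) v =
      cg q y (v (Fin.last (k + 2)) - (n (k + 3) - b) - c) (v (Fin.last (k + 2))) *
        treeComb q k b (v (Fin.last (k + 2)) - (n (k + 3) - b) - c)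
          (v (Fin.last (k + 2)) - y + x - n (k + 3)) n s (Fin.init v) := by
  simp only [treeComb]
  rw [comb, seq_snoc _ _ _ _ le_rfl, seq_succ_of_le _ _ _ le_rfl,
    comb_congr (ρ' := multLabel (seq (n 1) s b) n) (k + 1) fun i hi => by
      rw [multLabel, multLabel, seq_snoc _ _ _ _ hi, seq_snoc _ _ _ _ (by omega)]]
  have e : multLabel (seq (n 1) (Fin.snoc s b : Fin (k + 1) → ℤ) x) n (k + 1 + 1) =
      x - seq (n 1) s b k + n (k + 2) - n (k + 3) := by
    rw [multLabel, seq_succ_of_le _ _ _ le_rfl, show k + 1 + 1 - 2 = k by omega,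
      seq_snoc _ _ _ _ (by omega)]
  rw [e]
  have e1 : (v (Fin.last (k + 2)) : ℤ) - (n (k + 1 + 2) - b + c) =
    v (Fin.last (k + 2)) - (n (k + 3) - b) - c := by ring
  have e2 : x - seq (n 1) s b k + n (k + 2) - n (k + 3) - y + v (Fin.last (k + 2)) =
      n (k + 2) - seq (n 1) s b k + (v (Fin.last (k + 2)) - y + x - n (k + 3)) := by ring
  rw [← e2, ← e1]

/-- The expansion of the right-branched trees in the left-branched ones, on coefficients. -/
lemma treeComb_hasSum (k : ℕ) (n r : ℕ → ℤ) (hr : r 0 = n 2) (x y c : ℤ) (v : Fin (k + 2) → ℕ) :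
    HasSum (fun s : Fin k → ℤ => couplingProd q k x n r s * treeComb q k x y c n s v)
      (combR q (multLabel r fun i => n (i + 1)) k y (r k - n 1 + c)
        (x - n 1 + r (k - 1) - n (k + 2)) v) := by
  induction k generalizing x y c with
  | zero =>
    have h := hasSum_fintype fun s : Fin 0 → ℤ => couplingProd q 0 x n r s * treeComb q 0 x y c n s v
    convert h using 1
    rw [Fintype.sum_unique, couplingProd, Finset.Icc_eq_empty (by omega), Finset.prod_empty,
      one_mul]
    have e0 : v (Fin.last 1) = v 1 := rfl
    have e1 : Fin.tail v 0 = v 1 := rfl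
    have e2 : Fin.init v 0 = v 0 := rfl
    simp only [combR, treeComb, comb, seq, Nat.reduceAdd, e0, e1, e2, zero_add, hr, mul_ite,
      mul_one, mul_zero]
    by_cases hv : (v 1 : ℤ) = v 0 + (n 2 - n 1 + c)
    · rw [if_pos hv, if_pos (by omega), hv, add_sub_cancel_right]
    · rw [if_neg hv, if_neg (by omega)]
  | succ k ih =>
    by_cases hy : y < 0
    · simp [combR, treeComb, comb, cg_of_neg_left q hy]
    -- Absolute convergence at the coordinate v comes first; the value of the sum is then found by
    -- summing over all labels but the last, and finally over b.
    have hE : SqSummable fun s => treeComb q (k + 1) x y c n s v :=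
      (bessel_coord (fun s => sqSummable_treeComb hq₀ hq₁ (k + 1) x y c n s)
        (treeComb_orthonormal hq₀ hq₁ (k + 1) x c (not_lt.1 hy) n) v).1
    have hsum := (sqSummable_couplingProd_and_le hq₀ hq₁ (k + 1) x n r).1.mul hE
    obtain ⟨a, ha⟩ := hsum
    suffices h : a = combR q (multLabel r fun i => n (i + 1)) (k + 1) y (r (k + 1) - n 1 + c)
        (x - n 1 + r (k + 1 - 1) - n (k + 1 + 2)) v by rwa [h] at ha
    rw [← (Fin.snocEquiv (fun _ => ℤ)).hasSum_iff] at ha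
    have hb := fun b : ℤ => (ih b (v (Fin.last (k + 2)) - (n (k + 3) - b) - c)
      (v (Fin.last (k + 2)) - y + x - n (k + 3)) (Fin.init v)).mul_left
        (racahReal q x (n 1) (r k) (n (k + 3)) (r (k + 1)) b *
          cg q y (v (Fin.last (k + 2)) - (n (k + 3) - b) - c) (v (Fin.last (k + 2))))
    have h1 := ha.prod_fiberwise fun b => (hb b).congr_fun fun s => by
      simp only [Function.comp_apply]
      change couplingProd q (k + 1) x n r (Fin.snoc s b : Fin (k + 1) → ℤ) *
        treeComb q (k + 1) x y c n (Fin.snoc s b : Fin (k + 1) → ℤ) v = _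
      rw [couplingProd_snoc, treeComb_snoc]
      ring
    have h2 := combR_succ_hasSum hq₀ hq₁ (multLabel r fun i => n (i + 1)) k (not_lt.1 hy)
      (r (k + 1) - n 1) (x - n 1 + r k - n (k + 3)) c v
    rw [← (Equiv.subLeft (n (k + 3))).hasSum_iff] at h2
    refine h1.unique (h2.congr_fun fun b => ?_)
    simp only [Function.comp_apply, Equiv.subLeft_apply]
    rw [racahReal, mul_assoc]
    congr 3
    · ring
    · rw [multLabel, show k + 1 - 2 = k - 1 by omega]
      ring

end

/-! ### Expansions in the Hilbert space -/

lemma isL2_iff {N : ℕ} {f : (Fin N → ℕ) → ℝ} : IsL2 f ↔ SqSummable f := by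
  rw [IsL2, memℓp_gen_iff (by norm_num)]
  exact summable_congr fun v => by simp

lemma toL2_apply {N : ℕ} {f : (Fin N → ℕ) → ℝ} (hf : SqSummable f) (v : Fin N → ℕ) :
    toL2 f v = (f v : ℂ) := by
  rw [toL2, dif_pos (isL2_iff.2 hf)]

lemma inner_toL2 {N : ℕ} {f g : (Fin N → ℕ) → ℝ} (hf : SqSummable f) (hg : SqSummable g) :
    inner ℂ (toL2 f) (toL2 g) = ((∑' v, f v * g v : ℝ) : ℂ) := by
  rw [lp.inner_eq_tsum, Complex.ofReal_tsum]
  refine tsum_congr fun v => ?_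
  rw [toL2_apply hf, toL2_apply hg, RCLike.inner_apply, Complex.conj_ofReal]
  push_cast
  ring

section expansion

variable {N : ℕ} {κ : Type*} [DecidableEq κ] {f : κ → (Fin N → ℕ) → ℝ}
  (hf : ∀ k, SqSummable (f k))
include hf

lemma orthonormal_toL2 (ho : ∀ k k', ∑' i, f k i * f k' i = if k = k' then 1 else 0) :
    Orthonormal ℂ fun k => toL2 (f k) := by
  rw [orthonormal_iff_ite]
  intro k k'
  rw [inner_toL2 (hf k) (hf k'), ho]
  split_ifs <;> simp

/-- A pointwise expansion with square summable coefficients in an orthonormal family converges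
in norm. -/
lemma hasSum_toL2 (ho : ∀ k k', ∑' i, f k i * f k' i = if k = k' then 1 else 0) {a : κ → ℝ}
    (ha : SqSummable a) {g : (Fin N → ℕ) → ℝ} (hg : ∀ v, HasSum (fun k => a k * f k v) (g v)) :
    SqSummable g ∧ HasSum (fun k => (a k : ℂ) • toL2 (f k)) (toL2 g) := by
  have h := orthonormal_toL2 hf ho
  have hsum : Summable fun k => (a k : ℂ) • toL2 (f k) := by
    have := h.orthogonalFamily.summable_iff_norm_sq_summable (f := fun k => (a k : ℂ))
    simp only [LinearIsometry.toSpanSingleton_apply] at this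
    exact this.2 (ha.congr fun k => by simp)
  obtain ⟨W, hW⟩ := hsum
  have hWg : ∀ v, W v = (g v : ℂ) := by
    intro v
    have h1 := (lp.evalCLM ℂ (fun _ : Fin N → ℕ => ℂ) 2 v).hasSum hW
    have h2 := Complex.ofRealCLM.hasSum (hg v)
    refine h1.unique (h2.congr_fun fun k => ?_)
    change ((a k : ℂ) • toL2 (f k)) v = ((a k * f k v : ℝ) : ℂ)
    rw [lp.coeFn_smul, Pi.smul_apply, toL2_apply (hf k), smul_eq_mul]
    push_cast
    rfl
  have hgs : SqSummable g := by
    rw [← isL2_iff, IsL2, ← funext hWg]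
    exact lp.memℓp W
  refine ⟨hgs, ?_⟩
  have : toL2 g = W := by
    ext v
    rw [toL2_apply hgs, hWg]
  rwa [this]

end expansion

lemma treeS_eq (q : ℝ) {k : ℕ} (n : Fin (k + 2) → ℤ) (s : Fin k → ℤ) (x y : ℤ) :
    treeS q n s x y = treeComb q k x y 0 (leaf n) s := by
  simp only [treeS, treeComb, add_zero]

lemma treeR_eq (q : ℝ) {k : ℕ} (n : Fin (k + 2) → ℤ) (r : Fin k → ℤ) (x y : ℤ) :
    treeR q n r x y = combR q (multLabel (seq (leaf n 2) r 0) fun i => leaf n (i + 1)) k y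
      (seq (leaf n 2) r 0 k - leaf n 1 + 0)
      (x - leaf n 1 + seq (leaf n 2) r 0 (k - 1) - leaf n (k + 2)) := by
  funext v
  simp only [treeR, combR, add_zero]

section

variable {q : ℝ} (hq₀ : 0 < q) (hq₁ : q < 1)
include hq₀ hq₁

/-- Independence of the level replaces max(x,0) by 0. -/
lemma racah_eq (x n₁ n₂ n₃ a b : ℤ) :
    racah q x n₁ n₂ n₃ a b = (racahReal q x n₁ n₂ n₃ a b : ℂ) := by
  rw [racah, sixJ, inner_toL2 (sqSummable_eLeft hq₀ hq₁ _ _ _) (sqSummable_eRight hq₀ hq₁ _ _ _),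
    racahReal, ← pairing_eq_pairing_zero hq₀ hq₁ x.toNat]
  rfl

variable {k : ℕ} (n : Fin (k + 2) → ℤ) (r : Fin k → ℤ) (x : ℤ)

lemma orthonormal_treeS (y : ℕ) : Orthonormal ℂ fun s : Fin k → ℤ => toL2 (treeS q n s x y) := by
  simp only [treeS_eq]
  exact orthonormal_toL2 (fun s => sqSummable_treeComb hq₀ hq₁ k x y 0 _ s)
    (treeComb_orthonormal hq₀ hq₁ k x 0 (by positivity) (leaf n))

lemma treeR_hasSum (y : ℕ) : SqSummable (treeR q n r x y) ∧
    HasSum (fun s : Fin k → ℤ =>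
      (couplingProd q k x (leaf n) (seq (leaf n 2) r 0) s : ℂ) • toL2 (treeS q n s x y))
      (toL2 (treeR q n r x y)) := by
  simp only [treeS_eq, treeR_eq]
  exact hasSum_toL2 (fun s => sqSummable_treeComb hq₀ hq₁ k x y 0 _ s)
    (treeComb_orthonormal hq₀ hq₁ k x 0 (by positivity) (leaf n))
    (sqSummable_couplingProd_and_le hq₀ hq₁ k x _ _).1
    (treeComb_hasSum hq₀ hq₁ k (leaf n) (seq (leaf n 2) r 0) rfl x y 0)

omit hq₀ hq₁ in
lemma eq_inner_of_hasSum {E κ : Type*} [NormedAddCommGroup E] [InnerProductSpace ℂ E]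
    {e : κ → E} (he : Orthonormal ℂ e) {c : κ → ℂ} {w : E} (h : HasSum (fun k => c k • e k) w)
    (k : κ) : c k = inner ℂ (e k) w := by
  classical
  have h1 := (innerSL ℂ (e k)).hasSum h
  refine ((hasSum_ite_eq k (c k)).congr_fun fun j => ?_).unique h1
  rw [innerSL_apply_apply, inner_smul_right, orthonormal_iff_ite.1 he]
  by_cases hj : j = k
  · subst hj; simp
  · simp [hj, Ne.symm hj]

lemma couplingS_eq (s : Fin k → ℤ) : couplingS q x n r s =
    (couplingProd q k x (leaf n) (seq (leaf n 2) r 0) s : ℂ) :=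
  (eq_inner_of_hasSum (orthonormal_treeS hq₀ hq₁ n x x.toNat)
    (treeR_hasSum hq₀ hq₁ n r x x.toNat).2 s).symm

end

end QSU2

end

theorem mainTheorem10 (q : ℝ) (hq₀ : 0 < q) (hq₁ : q < 1) (k : ℕ) (hk : 1 ≤ k)
    (x : ℤ) (n : Fin (k + 2) → ℤ) (r : Fin k → ℤ) :
    -- `S` is the family of coefficients in the expansion of one tree in the trees of the other
    -- shape; the vector of a tree with root label `x ≥ 0` is the case `y = x`
    (∀ y : ℕ,
      QSU2.IsL2 (QSU2.treeR q n r x y) ∧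
      (∀ s : Fin k → ℤ, QSU2.IsL2 (QSU2.treeS q n s x y)) ∧
      ∀ c : (Fin k → ℤ) → ℂ,
        HasSum (fun s : Fin k → ℤ => c s • QSU2.toL2 (QSU2.treeS q n s x y))
            (QSU2.toL2 (QSU2.treeR q n r x y)) ↔
          ∀ s : Fin k → ℤ, c s = QSU2.couplingS q x n r s) ∧
    -- the product formula
    ∀ s : Fin k → ℤ,
      QSU2.couplingS q x n r s =
        ∏ j ∈ Finset.Icc 1 k,
          QSU2.racah q (QSU2.seq (QSU2.leaf n 1) s x (j + 1)) (QSU2.leaf n 1)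
            (QSU2.seq (QSU2.leaf n 2) r 0 (j - 1)) (QSU2.leaf n (j + 2))
            (QSU2.seq (QSU2.leaf n 2) r 0 j) (QSU2.seq (QSU2.leaf n 1) s x j) := by
  have hS := QSU2.couplingS_eq hq₀ hq₁ n r x
  refine ⟨fun y => ?_, fun s => ?_⟩
  · obtain ⟨h1, h2⟩ := QSU2.treeR_hasSum hq₀ hq₁ n r x y
    refine ⟨QSU2.isL2_iff.2 h1, fun s => ?_, fun c => ⟨fun h s => ?_, fun h => ?_⟩⟩
    · rw [QSU2.isL2_iff, QSU2.treeS_eq]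
      exact QSU2.sqSummable_treeComb hq₀ hq₁ k x y 0 _ s
    · have ho := QSU2.orthonormal_treeS hq₀ hq₁ n x y
      rw [hS, QSU2.eq_inner_of_hasSum ho h s, ← QSU2.eq_inner_of_hasSum ho h2 s]
    · simpa only [h, hS] using h2
  · rw [hS, QSU2.couplingProd, Complex.ofReal_prod]
    exact Finset.prod_congr rfl fun j _ => (QSU2.racah_eq hq₀ hq₁ _ _ _ _ _ _).symm
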